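/- **Setting.** Let $K$ be a field of characteristic $0$ and $r,\tilde r\ge 0$ integers. Consider independent variables $\xi=(x,y,z,\tilde x,\tilde y,\tilde z)$, $$x_i,\,y_i\ (0\le i\le r-1),\quad z_i\ (0\le i\le r-2),\qquad \tilde x_i,\,\tilde y_i\ (0\le i\le\tilde r-1),\quad \tilde z_i\ (0\le i\le\tilde r-2),$$ where the variables $y_i$ are absent if $\tilde r=0$ and the variables $\tilde y_i$ are absent if $r=0$ (absent variables and their exponents are read as $0$). In the ring $K[[\xi]]$ consider the system $$u_i=u_{i-1}-x_{i-1}u_1u_i-y_{i-1}\tilde u_1u_i+z_{i-1}u_{i+1}\quad(1\le i\le r),$$ $$\tilde u_i=\tilde u_{i-1}-\tilde x_{i-1}\tilde u_1\tilde u_i-\tilde y_{i-1}u_1\tilde u_i+\tilde z_{i-1}\tilde u_{i+1}\quad(1\le i\le\tilde r),$$ with $u_0=\tilde u_0=1$ and $z_{r-1}=\tilde z_{\tilde r-1}=0$ (the eigenvector equations of a Jacobi matrix of order $d=r+\tilde r+1$, after rescaling). This system has exactly one solution $(u_1,\dots,u_r,\tilde u_1,\dots,\tilde u_{\tilde r})$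 in formal power series. Define the Lagrange variables $\eta=(s,t,w,\tilde s,\tilde t,\tilde w)$, matching $\xi=(x,y,z,\tilde x,\tilde y,\tilde z)$, by $$s_i=x_iu_1,\quad t_i=y_i\tilde u_1,\quad w_i=z_i\frac{u_{i+2}}{u_i},\qquad \tilde s_i=\tilde x_i\tilde u_1,\quad \tilde t_i=\tilde y_iu_1,\quad \tilde w_i=\tilde z_i\frac{\tilde u_{i+2}}{\tilde u_i}.$$ **Notation.** An integer exponent vector is written $q=(m,n,p,\tilde m,\tilde n,\tilde p)$, so that $\xi^q=x^my^nz^p\tilde x^{\tilde m}\tilde y^{\tilde n}\tilde z^{\tilde p}$, and similarly $\eta^{q'}=s^{m'}t^{n'}w^{p'}\tilde s^{\tilde m'}\tilde t^{\tilde n'}\tilde w^{\tilde p'}$. Put $p_{r-1}=\tilde p_{\tilde r-1}=p'_{r-1}=\tilde p'_{\tilde r-1}=0$ and $$p_{-1}=\sum_{j=0}^{r-1}m_j+\sum_{j=0}^{\tilde r-1}\tilde n_j,\qquad \tilde p_{-1}=\sum_{j=0}^{\tilde r-1}\tilde m_j+\sum_{j=0}^{r-1}n_j .$$ Let $\delta_{ij}$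 be the Kronecker symbol, $\sigma_{ij}=1$ if $i>j$ and $\sigma_{ij}=0$ if $i\le j$. For integers $a,m,n$ let $\binom am=\frac{a(a-1)\cdots(a-m+1)}{m!}$ if $m\ge0$ and $\binom a{m,n}=\frac{a(a-1)\cdots(a-m-n+1)}{m!\,n!}$ if $m,n\ge0$; these symbols are $0$ if a lower entry is negative. **Theorem 4.** For every integer vector $q'$ the Laurent monomial $\eta^{q'}$ has the Laurent series expansion $$\eta^{q'}=\sum_{q\ge q'}\mathcal H_{q'q}\,\xi^q,\qquad \mathcal H_{q'q}=[\xi^q]\,\eta^{q'}=\sum_{i=-1}^{r-1}\sum_{\tilde\iota=-1}^{\tilde r-1}\mathcal F^i_{q'q}\widetilde{\mathcal F}^{\tilde\iota}_{q'q}-\sum_{i=0}^{r-1}\sum_{\tilde\iota=0}^{\tilde r-1}\mathcal G^i_{q'q}\widetilde{\mathcal G}^{\tilde\iota}_{q'q},$$ where $q\ge q'$ is understood component-wise, $$\mathcal F^i_{q'q}=\prod_{j=0}^{r-1}\binom{-p_{j-1}-p_j-\delta_{ij}}{m_j-m'_j-\delta_{ij},\;n_j-n'_j}\binom{p_{j-1}+p_j+\delta_{ij}-1}{p_j-p'_j-\sigma_{ij}},$$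 $$\mathcal G^i_{q'q}=\prod_{j=0}^{r-1}\binom{-p_{j-1}-p_j-\delta_{ij}}{m_j-m'_j,\;n_j-n'_j-\delta_{ij}}\binom{p_{j-1}+p_j+\delta_{ij}-1}{p_j-p'_j-\sigma_{ij}},$$ and $\widetilde{\mathcal F}^{\tilde\iota}_{q'q}$, $\widetilde{\mathcal G}^{\tilde\iota}_{q'q}$ are given by the same formulas with $r,m,n,p,m',n',p'$ replaced by their tilded versions. Moreover this expression for $\mathcal H_{q'q}$ vanishes for every integer vector $q$ that does not satisfy $q\ge q'$. -/

import Mathlib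

open scoped Nat

noncomputable section

/-! Variables. -/

/-- Labels of the untilded half of the variables: `r` labels for `x` (or `s`, `m`), `r` labels for
`y` (or `t`, `n`), `r - 1` labels for `z` (or `w`, `p`). The middle family is absent if the other
half is empty, i.e. if `ρ = 0`. -/
abbrev HalfIndex (r ρ : ℕ) : Type := Fin r ⊕ ({_i : Fin r // 0 < ρ} ⊕ Fin (r - 1))

/-- Labels of all variables `(x, y, z, x̃, ỹ, z̃)`, or `(s, t, w, s̃, t̃, w̃)`, or of the exponents
`(m, n, p, m̃, ñ, p̃)`. Here `ρ` stands for `r̃`. The tilde-symmetry is composition with `Sum.swap`,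
which turns a family labelled by `Index r ρ` into one labelled by `Index ρ r`. -/
abbrev Index (r ρ : ℕ) : Type := HalfIndex r ρ ⊕ HalfIndex ρ r

variable {r ρ : ℕ}

/-- The tilde-symmetry. -/
def tilde {A : Type*} (v : Index r ρ → A) : Index ρ r → A := fun l => v l.swap

section Components

variable {A : Type*} [Zero A]

/-- `x_j`, `s_j` or `m_j`, for `j = 0, …, r - 1`. -/
def fstAt (v : Index r ρ → A) (j : ℕ) : A :=
  if h : j < r then v (.inl (.inl ⟨j, h⟩)) else 0

/-- `y_j`, `t_j` or `n_j`, for `j = 0, …, r - 1` (all equal to `0` if `ρ = 0`). -/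
def sndAt (v : Index r ρ → A) (j : ℕ) : A :=
  if h : j < r ∧ 0 < ρ then v (.inl (.inr (.inl ⟨⟨j, h.1⟩, h.2⟩))) else 0

/-- `z_j`, `w_j` or `p_j`, for `j = 0, …, r - 2`, with the value `0` for `j = r - 1`. -/
def trdAt (v : Index r ρ → A) (j : ℕ) : A :=
  if h : j < r - 1 then v (.inl (.inr (.inr ⟨j, h⟩))) else 0

end Components

/-! The quadratic system and the Lagrange variables. -/

/-- The sequence `u_0 = 1, u_1, …, u_r` made of the unknowns `u_1, …, u_r`
(with the irrelevant value `0` beyond `r`). -/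
def extU {A : Type*} [Zero A] [One A] (u : Fin r → A) : ℕ → A
  | 0 => 1
  | i + 1 => if h : i < r then u ⟨i, h⟩ else 0

/-- The untilded half of the quadratic system:
`u_i = u_{i-1} - x_{i-1} u_1 u_i - y_{i-1} ũ_1 u_i + z_{i-1} u_{i+1}` for `i = 1, …, r`. -/
def HalfSystem {A : Type*} [CommRing A] (ξ : Index r ρ → A) (u : Fin r → A) (ut : Fin ρ → A) :
    Prop :=
  ∀ i < r, extU u (i + 1) = extU u i - fstAt ξ i * extU u 1 * extU u (i + 1)
    - sndAt ξ i * extU ut 1 * extU u (i + 1) + trdAt ξ i * extU u (i + 2)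

/-- The quadratic system for `u_1, …, u_r, ũ_1, …, ũ_ρ`, in the ring of formal power series
in the variables `ξ = (x, y, z, x̃, ỹ, z̃)`. -/
def IsSolution {K : Type*} [Field K] (u : Fin r → MvPowerSeries (Index r ρ) K)
    (ut : Fin ρ → MvPowerSeries (Index r ρ) K) : Prop :=
  HalfSystem (fun l => MvPowerSeries.X l) u ut ∧
    HalfSystem (tilde fun l => MvPowerSeries.X l) ut u

/-- `s_i = x_i u_1`, `t_i = y_i ũ_1`, `w_i = z_i u_{i+2} / u_i`. -/
def halfLagrangeVar {L : Type*} [Field L] (ξ : Index r ρ → L) (u : Fin r → L) (ut : Fin ρ → L) :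
    HalfIndex r ρ → L
  | .inl i => ξ (.inl (.inl i)) * extU u 1
  | .inr (.inl i) => ξ (.inl (.inr (.inl i))) * extU ut 1
  | .inr (.inr i) => ξ (.inl (.inr (.inr i))) * (extU u ((i : ℕ) + 2) / extU u (i : ℕ))

/-- The Lagrange variables `η = (s, t, w, s̃, t̃, w̃)`, in the fraction field of the ring of formal
power series in `ξ`. -/
def lagrangeVar {K : Type*} [Field K] (u : Fin r → MvPowerSeries (Index r ρ) K)
    (ut : Fin ρ → MvPowerSeries (Index r ρ) K) :
    Index r ρ → FractionRing (MvPowerSeries (Index r ρ) K) :=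
  let ι := algebraMap (MvPowerSeries (Index r ρ) K) (FractionRing (MvPowerSeries (Index r ρ) K))
  let ξ : Index r ρ → FractionRing (MvPowerSeries (Index r ρ) K) :=
    fun l => ι (MvPowerSeries.X l)
  Sum.elim (halfLagrangeVar ξ (fun i => ι (u i)) (fun i => ι (ut i)))
    (halfLagrangeVar (tilde ξ) (fun i => ι (ut i)) (fun i => ι (u i)))

/-- `f` is the multiple Laurent series `∑ c_q ξ^q`, the sum being over integer vectors `q`:
for some vector `a` of natural numbers `f ξ^a` is a formal power series `h`, and
`c_q` is the coefficient of `ξ^(q+a)` in `h`, which is `0` unless `q + a ≥ 0`. -/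
def IsLaurentExpansion {σ K : Type*} [Finite σ] [Field K]
    (f : FractionRing (MvPowerSeries σ K)) (c : (σ → ℤ) → K) : Prop :=
  ∃ (a : σ →₀ ℕ) (h : MvPowerSeries σ K),
    f * algebraMap _ _ (MvPowerSeries.monomial a (1 : K)) = algebraMap _ _ h ∧
    (∀ e : σ →₀ ℕ, c (fun l => (e l : ℤ) - a l) = MvPowerSeries.coeff e h) ∧
    ∀ q : σ → ℤ, (∃ l, q l + a l < 0) → c q = 0

/-! The coefficients. -/

/-- `a (a-1) ⋯ (a-m+1) / m!`, and `0` if `m < 0`. -/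
def binom (a m : ℤ) : ℚ :=
  if 0 ≤ m then (∏ k ∈ Finset.range m.toNat, ((a : ℚ) - k)) / (m.toNat ! : ℚ) else 0

/-- `a (a-1) ⋯ (a-m-n+1) / (m! n!)`, and `0` if `m < 0` or `n < 0`. -/
def trinom (a m n : ℤ) : ℚ :=
  if 0 ≤ m ∧ 0 ≤ n then
    (∏ k ∈ Finset.range (m.toNat + n.toNat), ((a : ℚ) - k)) / ((m.toNat ! : ℚ) * (n.toNat ! : ℚ))
  else 0

/-- The step function `σ_{ij}`. -/
def stepFn (i j : ℤ) : ℤ := if i ≤ j then 0 else 1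

/-- The Kronecker symbol `δ_{ij}`. -/
def kron (i j : ℤ) : ℤ := if i = j then 1 else 0

/-- `pPrev q j` is `p_{j-1}`, where `p_{-1} = |m| + |ñ|`. -/
def pPrev (q : Index r ρ → ℤ) : ℕ → ℤ
  | 0 => ∑ j ∈ Finset.range r, fstAt q j + ∑ j ∈ Finset.range ρ, sndAt (tilde q) j
  | j + 1 => trdAt q j

/-- `F^i_{q'q}`, with `qp` for `q'`. -/
def coeffF (qp q : Index r ρ → ℤ) (i : ℤ) : ℚ :=
  ∏ j ∈ Finset.range r,
    trinom (-pPrev q j - trdAt q j - kron i j)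
        (fstAt q j - fstAt qp j - kron i j) (sndAt q j - sndAt qp j) *
      binom (pPrev q j + trdAt q j + kron i j - 1) (trdAt q j - trdAt qp j - stepFn i j)

/-- `G^i_{q'q}`, with `qp` for `q'`. -/
def coeffG (qp q : Index r ρ → ℤ) (i : ℤ) : ℚ :=
  ∏ j ∈ Finset.range r,
    trinom (-pPrev q j - trdAt q j - kron i j)
        (fstAt q j - fstAt qp j) (sndAt q j - sndAt qp j - kron i j) *
      binom (pPrev q j + trdAt q j + kron i j - 1) (trdAt q j - trdAt qp j - stepFn i j)

/-- `H_{q'q}`, with `qp` for `q'`; the tilded factors are obtained by the tilde-symmetry. The first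
double sum is over `-1 ≤ i ≤ r - 1` and `-1 ≤ k ≤ ρ - 1` (both indices shifted by one), the second
one over `0 ≤ i ≤ r - 1` and `0 ≤ k ≤ ρ - 1`. -/
def coeffH (qp q : Index r ρ → ℤ) : ℚ :=
  (∑ i ∈ Finset.range (r + 1), ∑ k ∈ Finset.range (ρ + 1),
      coeffF qp q ((i : ℤ) - 1) * coeffF (tilde qp) (tilde q) ((k : ℤ) - 1)) -
    ∑ i ∈ Finset.range r, ∑ k ∈ Finset.range ρ,
      coeffG qp q (i : ℤ) * coeffG (tilde qp) (tilde q) (k : ℤ)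

end

/-! ### Binomial and trinomial coefficients -/

/-! Put φ_j = (1 + w_j)/(1 + s_j + t_j). In the Lagrange variables the system reads u_{j+1} = φ_j
u_j. Hence each η_l is ξ_l times a product of φ's, and ξ^q = η^q φ^{-q}, where φ^q is the product of
the φ_j^{p_{j-1}+p_j} and their tilded versions. The theorem is an explicit Lagrange inversion for
this change of variables, and it is verified without a Jacobian determinant.

Let C_{α,β} be the series with coefficients `fullCoeff α β`, where free parameters α_j, β_j replace
p_{j-1}+p_j and its tilded version; let C_e be the one with the parameters of e. The core is [ξ^e]
g(η(ξ)) = [η^e] (g C_e) for every series g (`coeff_subst_lagrangeSeries`). Both sides are linear in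
g and see only degrees up to |e|, so it suffices to test g = η^b φ^{-b}, whose leading term is η^b
(`MvPowerSeries.linearMap_eq_zero`). The left side is then [ξ^e] ξ^b. On the right, Pascal's rules
(`fullCoeff_pascal`) make multiplication by φ^q a translation of the parameters
(`phi_mul_coeffSeries`), which leaves the coefficient of η^{e-b} in C_{e-b}. It is 1 for e = b by
`fullCoeff_zero` and 0 otherwise by `fullCoeff_pairSum`.

That diagonal vanishing is a cancellation. Write P = p_{-1}, let A be the product F^{-1}, and let
ΣF, ΣG be the sums over i. Then P·ΣF = A(P - |m|) = A|ñ| and P·ΣG = -A|n| (`mul_sumF`, `mul_sumG`),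
and symmetrically for the tilded half, so the two products in P·P̃·H agree. The cases P = 0 and P̃ =
0 are treated directly.

The theorem follows with g = η^b φ^{-a}, b - a = q'. The system has exactly one solution because its
telescoped form is a contraction for the degree filtration. -/

theorem binom_natCast (a : ℤ) (m : ℕ) :
    binom a m = (∏ k ∈ Finset.range m, ((a : ℚ) - k)) / (m ! : ℚ) := by
  simp [binom]

theorem binom_of_neg (a : ℤ) {m : ℤ} (h : m < 0) : binom a m = 0 := by
  simp [binom, not_le.2 h]

theorem trinom_natCast (a : ℤ) (m n : ℕ) :
    trinom a m n = (∏ k ∈ Finset.range (m + n), ((a : ℚ) - k)) / ((m ! : ℚ) * (n ! : ℚ)) := by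
  simp [trinom]

theorem trinom_of_neg_left (a n : ℤ) {m : ℤ} (h : m < 0) : trinom a m n = 0 := by
  simp [trinom, not_le.2 h]

theorem trinom_of_neg_right (a m : ℤ) {n : ℤ} (h : n < 0) : trinom a m n = 0 := by
  simp [trinom, not_le.2 h]

theorem trinom_comm (a m n : ℤ) : trinom a m n = trinom a n m := by
  simp only [trinom, and_comm, add_comm, mul_comm]

theorem binom_zero_right (a : ℤ) : binom a 0 = 1 := by
  simp [binom]

theorem trinom_zero_zero (a : ℤ) : trinom a 0 0 = 1 := by
  simp [trinom]

theorem prod_range_succ_sub_natCast (a : ℚ) (n : ℕ) :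
    ∏ k ∈ Finset.range (n + 1), (a + 1 - k) = (a + 1) * ∏ k ∈ Finset.range n, (a - k) := by
  rw [Finset.prod_range_succ', mul_comm]
  congr 1
  · simp
  · refine Finset.prod_congr rfl fun k _ => ?_
    push_cast
    ring

theorem binom_mul_self (a p : ℤ) : p * binom a p = (a - p + 1) * binom a (p - 1) := by
  rcases lt_trichotomy p 0 with h | rfl | h
  · rw [binom_of_neg _ h, binom_of_neg _ (by omega)]; simp
  · rw [binom_of_neg (m := 0 - 1) _ (by omega)]; simp
  · obtain ⟨k, rfl⟩ : ∃ k : ℕ, p = (k : ℤ) + 1 := ⟨(p - 1).toNat, by omega⟩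
    rw [show ((k : ℤ) + 1) = ((k + 1 : ℕ) : ℤ) by push_cast; rfl, binom_natCast,
      show (((k + 1 : ℕ) : ℤ) - 1) = (k : ℤ) by push_cast; ring, binom_natCast,
      Finset.prod_range_succ, Nat.factorial_succ]
    have := Nat.factorial_ne_zero k
    push_cast
    field_simp
    ring

theorem binom_succ_left (a p : ℤ) : binom (a + 1) p = binom a p + binom a (p - 1) := by
  rcases lt_trichotomy p 0 with h | rfl | h
  · rw [binom_of_neg _ h, binom_of_neg _ h, binom_of_neg _ (by omega)]; simp
  · rw [binom_of_neg (m := 0 - 1) _ (by omega)]; simp [binom_zero_right]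
  · obtain ⟨k, rfl⟩ : ∃ k : ℕ, p = (k : ℤ) + 1 := ⟨(p - 1).toNat, by omega⟩
    rw [show ((k : ℤ) + 1) = ((k + 1 : ℕ) : ℤ) by push_cast; rfl, binom_natCast, binom_natCast,
      show (((k + 1 : ℕ) : ℤ) - 1) = (k : ℤ) by push_cast; ring, binom_natCast]
    push_cast
    rw [prod_range_succ_sub_natCast, Finset.prod_range_succ, Nat.factorial_succ]
    have := Nat.factorial_ne_zero k
    push_cast
    field_simp
    ring

theorem sub_mul_binom (a p : ℤ) : (a - p) * binom a p = a * binom (a - 1) p := by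
  have h1 := binom_succ_left (a - 1) p
  have h2 := binom_mul_self (a - 1) p
  rw [sub_add_cancel] at h1
  rw [h1]
  push_cast at h2
  linear_combination (-1 : ℚ) * h2

theorem mul_trinom (a m n : ℤ) : m * trinom a m n = a * trinom (a - 1) (m - 1) n := by
  rcases lt_or_ge n 0 with hn | hn
  · rw [trinom_of_neg_right _ _ hn, trinom_of_neg_right _ _ hn]; simp
  lift n to ℕ using hn
  rcases lt_trichotomy m 0 with h | rfl | h
  · rw [trinom_of_neg_left _ _ h, trinom_of_neg_left _ _ (by omega)]; simp
  · rw [trinom_of_neg_left (m := 0 - 1) _ _ (by omega)]; simp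
  · obtain ⟨k, rfl⟩ : ∃ k : ℕ, m = (k : ℤ) + 1 := ⟨(m - 1).toNat, by omega⟩
    obtain ⟨b, rfl⟩ : ∃ b : ℤ, a = b + 1 := ⟨a - 1, by omega⟩
    rw [show ((k : ℤ) + 1) = ((k + 1 : ℕ) : ℤ) by push_cast; rfl, trinom_natCast,
      show (((k + 1 : ℕ) : ℤ) - 1) = (k : ℤ) by push_cast; ring, add_sub_cancel_right,
      trinom_natCast, show k + 1 + n = (k + n) + 1 by ring]
    push_cast
    rw [prod_range_succ_sub_natCast, Nat.factorial_succ]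
    have := Nat.factorial_ne_zero k
    have := Nat.factorial_ne_zero n
    push_cast
    field_simp

/-- Coefficient comparison in (1+s+t)^{a+1} = (1+s+t)^a (1+s+t), for any integer a. -/
theorem trinom_succ_left (a m n : ℤ) :
    trinom (a + 1) m n = trinom a m n + trinom a (m - 1) n + trinom a m (n - 1) := by
  rcases lt_or_ge n 0 with hn | hn
  · rw [trinom_of_neg_right _ _ hn, trinom_of_neg_right _ _ hn, trinom_of_neg_right _ _ hn,
      trinom_of_neg_right _ _ (by omega)]; simp
  rcases lt_or_ge m 0 with hm | hm
  · rw [trinom_of_neg_left _ _ hm, trinom_of_neg_left _ _ hm, trinom_of_neg_left _ _ hm,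
      trinom_of_neg_left _ _ (by omega)]; simp
  lift n to ℕ using hn
  lift m to ℕ using hm
  obtain h0 | h0 := eq_or_ne (m + n) 0
  · obtain ⟨rfl, rfl⟩ : m = 0 ∧ n = 0 := by omega
    rw [trinom_of_neg_left _ _ (by simp : ((0 : ℕ) : ℤ) - 1 < 0),
      trinom_of_neg_right _ _ (by simp : ((0 : ℕ) : ℤ) - 1 < 0)]
    simp [trinom_zero_zero]
  obtain ⟨N, hN⟩ : ∃ N, m + n = N + 1 := Nat.exists_eq_succ_of_ne_zero h0
  have hNq : (m : ℚ) + n = N + 1 := by exact_mod_cast hN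
  -- All four symbols are multiples of Q/(m! n!); what remains is a + 1 = (a - N) + m + n.
  set Q : ℚ := ∏ k ∈ Finset.range N, ((a : ℚ) - k)
  have fm := Nat.factorial_ne_zero m
  have fn := Nat.factorial_ne_zero n
  have h1 : trinom (a + 1) m n = (a + 1) * Q / (m ! * n !) := by
    rw [trinom_natCast, hN]; push_cast; rw [prod_range_succ_sub_natCast]
  have h2 : trinom a m n = Q * (a - N) / (m ! * n !) := by
    rw [trinom_natCast, hN, Finset.prod_range_succ]
  have h3 : trinom a (m - 1) n = m * Q / (m ! * n !) := by
    rcases m with _ | m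
    · rw [trinom_of_neg_left _ _ (by simp)]; simp
    · rw [show (((m + 1 : ℕ) : ℤ) - 1) = (m : ℤ) by push_cast; ring, trinom_natCast,
        show m + n = N by omega, Nat.factorial_succ]
      have := Nat.factorial_ne_zero m
      push_cast
      field_simp
      rfl
  have h4 : trinom a m (n - 1) = n * Q / (m ! * n !) := by
    rcases n with _ | n
    · rw [trinom_of_neg_right _ _ (by simp)]; simp
    · rw [show (((n + 1 : ℕ) : ℤ) - 1) = (n : ℤ) by push_cast; ring, trinom_natCast,
        show m + n = N by omega, Nat.factorial_succ]
      have := Nat.factorial_ne_zero n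
      push_cast
      field_simp
      rfl
  rw [h1, h2, h3, h4]
  field_simp
  linear_combination (-Q) * hNq

/-- For p > 0 the falling product runs down to 0. With `trinom_zero_left` this makes a vanishing
p_{j-1} force all exponents of index j to vanish. -/
theorem binom_sub_one_self {p : ℤ} (hp : p ≠ 0) : binom (p - 1) p = 0 := by
  have h := binom_mul_self (p - 1) p
  have hp' : (p : ℚ) ≠ 0 := by exact_mod_cast hp
  push_cast at h
  rw [show ((p : ℚ) - 1 - p + 1) = 0 by ring, zero_mul] at h
  exact (mul_eq_zero.1 h).resolve_left hp'

theorem trinom_zero_left {m n : ℤ} (h : ¬ (m = 0 ∧ n = 0)) : trinom 0 m n = 0 := by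
  rcases eq_or_ne m 0 with rfl | hm
  · have h2 := mul_trinom 0 n 0
    have hn : (n : ℚ) ≠ 0 := by
      have : n ≠ 0 := fun h' => h ⟨rfl, h'⟩
      exact_mod_cast this
    rw [trinom_comm]
    simpa [hn] using h2
  · have h2 := mul_trinom 0 m n
    have hm : (m : ℚ) ≠ 0 := by exact_mod_cast hm
    simpa [hm] using h2

/-! ### The products `F^i` and `G^i` with free parameters -/

/-- The common shape of the products `F^i` and `G^i`, with `α_j` in place of `p_{j-1} + p_j`. -/
def halfProd (r : ℕ) (α m n p : ℕ → ℤ) (i : ℤ) : ℚ :=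
  ∏ j ∈ Finset.range r,
    trinom (-α j - kron i j) (m j) (n j) * binom (α j + kron i j - 1) (p j - stepFn i j)

theorem halfProd_congr {r : ℕ} {α α' m m' n n' p p' : ℕ → ℤ} {i : ℤ}
    (h : ∀ j < r, α j = α' j ∧ m j = m' j ∧ n j = n' j ∧ p j = p' j) :
    halfProd r α m n p i = halfProd r α' m' n' p' i := by
  refine Finset.prod_congr rfl fun j hj => ?_
  obtain ⟨h1, h2, h3, h4⟩ := h j (Finset.mem_range.1 hj)
  rw [h1, h2, h3, h4]

theorem halfProd_comm (r : ℕ) (α m n p : ℕ → ℤ) (i : ℤ) :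
    halfProd r α m n p i = halfProd r α n m p i := by
  refine Finset.prod_congr rfl fun j _ => ?_
  rw [trinom_comm]

theorem halfProd_eq_zero {r : ℕ} {α m n p : ℕ → ℤ} {i : ℤ} {j : ℕ} (hj : j < r)
    (h : m j < 0 ∨ n j < 0 ∨ p j - stepFn i j < 0) : halfProd r α m n p i = 0 := by
  refine Finset.prod_eq_zero (Finset.mem_range.2 hj) ?_
  rcases h with h | h | h
  · rw [trinom_of_neg_left _ _ h, zero_mul]
  · rw [trinom_of_neg_right _ _ h, zero_mul]
  · rw [binom_of_neg _ h, mul_zero]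

theorem kron_nonneg (i j : ℤ) : 0 ≤ kron i j := by unfold kron; split <;> simp

theorem stepFn_nonneg (i j : ℤ) : 0 ≤ stepFn i j := by unfold stepFn; split <;> simp

/-- Only the factor of index j changes. Its generating function is, up to a monomial, (1+s+t)^{-α-δ}
(1+w)^{α+δ-1}; raising α by 1 multiplies it by (1+w)/(1+s+t), and the identity is this relation with
denominators cleared. -/
theorem halfProd_pascal {r : ℕ} (α m n p : ℕ → ℤ) (i : ℤ) {j : ℕ} (hj : j < r) :
    halfProd r α m n p i + halfProd r α m n (p - Pi.single j 1) i =
      halfProd r (α + Pi.single j 1) m n p i +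
        halfProd r (α + Pi.single j 1) (m - Pi.single j 1) n p i +
        halfProd r (α + Pi.single j 1) m (n - Pi.single j 1) p i := by
  unfold halfProd
  simp only [← Finset.mul_prod_erase (Finset.range r) _ (Finset.mem_range.2 hj)]
  have key : ∀ α' m' n' p' : ℕ → ℤ, (∀ l ≠ j, α' l = α l ∧ m' l = m l ∧ n' l = n l ∧ p' l = p l) →
      ∏ l ∈ (Finset.range r).erase j, (trinom (-α' l - kron i l) (m' l) (n' l) *
        binom (α' l + kron i l - 1) (p' l - stepFn i l)) =
      ∏ l ∈ (Finset.range r).erase j, (trinom (-α l - kron i l) (m l) (n l) *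
        binom (α l + kron i l - 1) (p l - stepFn i l)) := by
    intro α' m' n' p' h
    refine Finset.prod_congr rfl fun l hl => ?_
    obtain ⟨h1, h2, h3, h4⟩ := h l (Finset.ne_of_mem_erase hl)
    rw [h1, h2, h3, h4]
  rw [key α m n (p - Pi.single j 1) (by intro l hl; simp [hl]),
    key (α + Pi.single j 1) m n p (by intro l hl; simp [hl]),
    key (α + Pi.single j 1) (m - Pi.single j 1) n p (by intro l hl; simp [hl]),
    key (α + Pi.single j 1) m (n - Pi.single j 1) p (by intro l hl; simp [hl])]
  have e1 := trinom_succ_left (-(α j + 1) - kron i j) (m j) (n j)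
  have e2 := binom_succ_left (α j + kron i j - 1) (p j - stepFn i j)
  rw [show -(α j + 1) - kron i j + 1 = -α j - kron i j by ring] at e1
  simp only [Pi.add_apply, Pi.sub_apply, Pi.single_eq_same]
  rw [show α j + kron i j - 1 + 1 = α j + 1 + kron i j - 1 by ring] at e2
  rw [show p j - 1 - stepFn i j = p j - stepFn i j - 1 by ring, ← add_mul, ← add_mul, ← add_mul,
    ← mul_add, ← e2, e1]
  ring

/-! ### The products at the diagonal -/

/-- The sequence `P, p_0, p_1, …`. -/
def prevSeq (P : ℤ) (p : ℕ → ℤ) : ℕ → ℤ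
  | 0 => P
  | j + 1 => p j

theorem kron_succ (i j : ℕ) : kron ((i + 1 : ℕ) : ℤ) ((j + 1 : ℕ) : ℤ) = kron i j := by
  simp [kron]

theorem stepFn_succ (i j : ℕ) : stepFn ((i + 1 : ℕ) : ℤ) ((j + 1 : ℕ) : ℤ) = stepFn i j := by
  simp [stepFn]

theorem kron_neg_one (j : ℕ) : kron (-1) j = 0 := by
  simp [kron]

theorem stepFn_neg_one (j : ℕ) : stepFn (-1) j = 0 := by
  simp [stepFn]

theorem halfProd_neg_one (r : ℕ) (α m n p : ℕ → ℤ) :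
    halfProd r α m n p (-1) =
      ∏ j ∈ Finset.range r, trinom (-α j) (m j) (n j) * binom (α j - 1) (p j) := by
  simp [halfProd, kron_neg_one, stepFn_neg_one]

/-- The factor P is passed along the product: each index j < i turns p_{j-1} into p_j while
restoring the lower entry that `stepFn` had decreased, and at j = i the factor p_{i-1} is exchanged
for -m_i. -/
theorem mul_halfProd (r : ℕ) (P : ℤ) (m n p : ℕ → ℤ) (i : ℕ) (hi : i < r) :
    P * halfProd r (fun j => prevSeq P p j + p j) (fun j => m j - kron i j) n p i =
      -(m i * halfProd r (fun j => prevSeq P p j + p j) m n p (-1)) := by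
  induction r generalizing P m n p i with
  | zero => omega
  | succ r ih =>
    -- Deleting index 0 leaves data of the same shape, with p_0 in the role of P.
    have hs : ∀ j, prevSeq P p (j + 1) = prevSeq (p 0) (fun j => p (j + 1)) j := by
      rintro (_ | j) <;> rfl
    rw [halfProd_neg_one, Finset.prod_range_succ', halfProd, Finset.prod_range_succ']
    rcases i with _ | i
    · have k0 : ∀ j : ℕ, kron ((0 : ℕ) : ℤ) ((j + 1 : ℕ) : ℤ) = 0 := fun j => by
        simp [kron]; omega
      have s0 : ∀ j : ℕ, stepFn ((0 : ℕ) : ℤ) ((j + 1 : ℕ) : ℤ) = 0 := fun j => by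
        simp [stepFn]; omega
      simp only [k0, s0, sub_zero, add_zero]
      have k1 : kron ((0 : ℕ) : ℤ) ((0 : ℕ) : ℤ) = 1 := by simp [kron]
      have s1 : stepFn ((0 : ℕ) : ℤ) ((0 : ℕ) : ℤ) = 0 := by simp [stepFn]
      simp only [k1, s1, prevSeq, sub_zero, add_sub_cancel_right]
      have e1 := mul_trinom (-(P + p 0)) (m 0) (n 0)
      have e2 := sub_mul_binom (P + p 0) (p 0)
      push_cast at e1 e2
      rw [add_sub_cancel_right] at e2
      linear_combination
        (∏ x ∈ Finset.range r, trinom (-(p x + p (x + 1))) (m (x + 1)) (n (x + 1)) *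
          binom (p x + p (x + 1) - 1) (p (x + 1))) *
        (trinom (-(P + p 0) - 1) (m 0 - 1) (n 0) * e2 + binom (P + p 0 - 1) (p 0) * e1)
    · simp only [kron_succ, stepFn_succ]
      have k1 : kron ((i + 1 : ℕ) : ℤ) ((0 : ℕ) : ℤ) = 0 := by simp [kron]; omega
      have s1 : stepFn ((i + 1 : ℕ) : ℤ) ((0 : ℕ) : ℤ) = 1 := by simp [stepFn]
      simp only [k1, s1, sub_zero, add_zero, hs]
      have e := ih (p 0) (fun j => m (j + 1)) (fun j => n (j + 1)) (fun j => p (j + 1)) i (by omega)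
      rw [halfProd_neg_one, halfProd] at e
      -- This is P·binom(P+p_0-1, p_0-1) = p_0·binom(P+p_0-1, p_0); the new factor p_0 is what the
      -- induction hypothesis needs.
      have e2 := binom_mul_self (P + p 0 - 1) (p 0)
      simp only [show prevSeq P p 0 = P from rfl]
      push_cast at e e2 ⊢
      rw [show ((P : ℚ) + p 0 - 1 - p 0 + 1) = P by ring] at e2
      linear_combination trinom (-(P + p 0)) (m 0) (n 0) * binom (P + p 0 - 1) (p 0) * e -
        trinom (-(P + p 0)) (m 0) (n 0) * (∏ j ∈ Finset.range r,
          trinom (-(prevSeq (p 0) (fun j => p (j + 1)) j + p (j + 1)) - kron i j)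
            (m (j + 1) - kron i j) (n (j + 1)) *
          binom (prevSeq (p 0) (fun j => p (j + 1)) j + p (j + 1) + kron i j - 1)
            (p (j + 1) - stepFn i j)) * e2

/-- If p_{j-1} = 0, the binomial factor is nonzero only for p_j = 0, and then the trinomial one only
for m_j = n_j = 0. The zero propagates from index j to j + 1. -/
theorem halfProd_zero_ne_zero (r : ℕ) (m n p : ℕ → ℤ)
    (h : halfProd r (fun j => prevSeq 0 p j + p j) m n p (-1) ≠ 0) :
    ∀ j < r, m j = 0 ∧ n j = 0 ∧ p j = 0 := by
  rw [halfProd_neg_one] at h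
  have hf := Finset.prod_ne_zero_iff.1 h
  intro j
  induction j with
  | zero =>
    intro hj
    have h0 := hf 0 (Finset.mem_range.2 hj)
    simp only [prevSeq, zero_add] at h0
    have hp : p 0 = 0 := by
      by_contra hp
      exact h0 (by rw [binom_sub_one_self hp, mul_zero])
    have hmn : m 0 = 0 ∧ n 0 = 0 := by
      by_contra hmn
      exact h0 (by rw [hp, neg_zero, trinom_zero_left hmn, zero_mul])
    exact ⟨hmn.1, hmn.2, hp⟩
  | succ j ih =>
    intro hj
    obtain ⟨-, -, hpj⟩ := ih (by omega)
    have h0 := hf (j + 1) (Finset.mem_range.2 hj)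
    simp only [prevSeq, hpj, zero_add] at h0
    have hp : p (j + 1) = 0 := by
      by_contra hp
      exact h0 (by rw [binom_sub_one_self hp, mul_zero])
    have hmn : m (j + 1) = 0 ∧ n (j + 1) = 0 := by
      by_contra hmn
      exact h0 (by rw [hp, neg_zero, trinom_zero_left hmn, zero_mul])
    exact ⟨hmn.1, hmn.2, hp⟩

theorem halfProd_of_zero (r : ℕ) (α m n p : ℕ → ℤ)
    (h : ∀ j < r, m j = 0 ∧ n j = 0 ∧ p j = 0) : halfProd r α m n p (-1) = 1 := by
  rw [halfProd_neg_one]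
  refine Finset.prod_eq_one fun j hj => ?_
  obtain ⟨h1, h2, h3⟩ := h j (Finset.mem_range.1 hj)
  rw [h1, h2, h3, trinom_zero_zero, binom_zero_right, mul_one]

/-! ### The sums over `i` -/

/-- The sum of the products `F^i` over `-1 ≤ i ≤ r - 1`, with free parameters. -/
def sumF (r : ℕ) (α m n p : ℕ → ℤ) : ℚ :=
  ∑ i ∈ Finset.range (r + 1), halfProd r α (fun j => m j - kron ((i : ℤ) - 1) j) n p ((i : ℤ) - 1)

/-- The sum of the products `G^i` over `0 ≤ i ≤ r - 1`, with free parameters. -/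
def sumG (r : ℕ) (α m n p : ℕ → ℤ) : ℚ :=
  ∑ i ∈ Finset.range r, halfProd r α m (fun j => n j - kron i j) p i

theorem sumF_eq (r : ℕ) (α m n p : ℕ → ℤ) :
    sumF r α m n p = halfProd r α m n p (-1) +
      ∑ i ∈ Finset.range r, halfProd r α (fun j => m j - kron i j) n p i := by
  rw [sumF, Finset.sum_range_succ', add_comm]
  simp [kron_neg_one]

theorem sumF_congr {r : ℕ} {α α' : ℕ → ℤ} (m n p : ℕ → ℤ) (h : ∀ j < r, α j = α' j) :
    sumF r α m n p = sumF r α' m n p :=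
  Finset.sum_congr rfl fun _ _ => halfProd_congr fun j hj => ⟨h j hj, rfl, rfl, rfl⟩

theorem sumG_congr {r : ℕ} {α α' : ℕ → ℤ} (m n p : ℕ → ℤ) (h : ∀ j < r, α j = α' j) :
    sumG r α m n p = sumG r α' m n p :=
  Finset.sum_congr rfl fun _ _ => halfProd_congr fun j hj => ⟨h j hj, rfl, rfl, rfl⟩

theorem sumF_eq_zero {r : ℕ} {α m n p : ℕ → ℤ} {j : ℕ} (hj : j < r)
    (h : m j < 0 ∨ n j < 0 ∨ p j < 0) : sumF r α m n p = 0 := by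
  refine Finset.sum_eq_zero fun i _ => halfProd_eq_zero hj ?_
  have := kron_nonneg ((i : ℤ) - 1) j
  have := stepFn_nonneg ((i : ℤ) - 1) j
  omega

theorem sumG_eq_zero {r : ℕ} {α m n p : ℕ → ℤ} {j : ℕ} (hj : j < r)
    (h : m j < 0 ∨ n j < 0 ∨ p j < 0) : sumG r α m n p = 0 := by
  refine Finset.sum_eq_zero fun i _ => halfProd_eq_zero hj ?_
  have := kron_nonneg (i : ℤ) j
  have := stepFn_nonneg (i : ℤ) j
  omega

theorem sumF_pascal {r : ℕ} (α m n p : ℕ → ℤ) {j : ℕ} (hj : j < r) :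
    sumF r α m n p + sumF r α m n (p - Pi.single j 1) =
      sumF r (α + Pi.single j 1) m n p + sumF r (α + Pi.single j 1) (m - Pi.single j 1) n p +
        sumF r (α + Pi.single j 1) m (n - Pi.single j 1) p := by
  simp only [sumF, ← Finset.sum_add_distrib]
  refine Finset.sum_congr rfl fun i _ => ?_
  rw [halfProd_pascal α _ n p _ hj]
  congr 3
  funext l
  simp only [Pi.sub_apply]
  ring

theorem sumG_pascal {r : ℕ} (α m n p : ℕ → ℤ) {j : ℕ} (hj : j < r) :
    sumG r α m n p + sumG r α m n (p - Pi.single j 1) =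
      sumG r (α + Pi.single j 1) m n p + sumG r (α + Pi.single j 1) (m - Pi.single j 1) n p +
        sumG r (α + Pi.single j 1) m (n - Pi.single j 1) p := by
  simp only [sumG, ← Finset.sum_add_distrib]
  refine Finset.sum_congr rfl fun i _ => ?_
  rw [halfProd_pascal α m _ p _ hj]
  congr 2
  funext l
  simp only [Pi.sub_apply]
  ring

/-- The term i = -1 contributes P, and each i ≥ 0 contributes -m_i by `mul_halfProd`. -/
theorem mul_sumF (r : ℕ) (P : ℤ) (m n p : ℕ → ℤ) :
    P * sumF r (fun j => prevSeq P p j + p j) m n p =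
      halfProd r (fun j => prevSeq P p j + p j) m n p (-1) *
        (P - ∑ j ∈ Finset.range r, (m j : ℚ)) := by
  rw [sumF_eq, mul_add, Finset.mul_sum,
    Finset.sum_congr rfl fun i hi => mul_halfProd r P m n p i (Finset.mem_range.1 hi),
    Finset.sum_neg_distrib, ← Finset.sum_mul]
  ring

/-- Exchanging m and n turns the terms of G into those of F with i ≥ 0; there is no term i = -1. -/
theorem mul_sumG (r : ℕ) (P : ℤ) (m n p : ℕ → ℤ) :
    P * sumG r (fun j => prevSeq P p j + p j) m n p =
      -(halfProd r (fun j => prevSeq P p j + p j) m n p (-1) *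
        ∑ j ∈ Finset.range r, (n j : ℚ)) := by
  rw [sumG, Finset.mul_sum, Finset.sum_congr rfl fun i hi => by
      rw [halfProd_comm, mul_halfProd r P n m p i (Finset.mem_range.1 hi), halfProd_comm],
    Finset.sum_neg_distrib, ← Finset.sum_mul]
  ring

/-- For i ≥ 0 the factor j = i has lower entry -1. This serves the case P = 0, where `mul_sumF`
carries no information on the sum. -/
theorem sumF_of_fst_zero (r : ℕ) (α m n p : ℕ → ℤ) (hm : ∀ j < r, m j = 0) :
    sumF r α m n p = halfProd r α m n p (-1) := by
  rw [sumF_eq, add_eq_left]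
  refine Finset.sum_eq_zero fun i hi => ?_
  have hi := Finset.mem_range.1 hi
  refine halfProd_eq_zero hi (Or.inl ?_)
  simp [hm i hi, kron]

theorem sumG_of_snd_zero (r : ℕ) (α m n p : ℕ → ℤ) (hn : ∀ j < r, n j = 0) :
    sumG r α m n p = 0 := by
  refine Finset.sum_eq_zero fun i hi => ?_
  have hi := Finset.mem_range.1 hi
  refine halfProd_eq_zero hi (Or.inr (Or.inl ?_))
  simp [hn i hi, kron]

/-! ### Exponent vectors -/

@[simp] theorem tilde_tilde {A : Type*} (v : Index r ρ → A) : tilde (tilde v) = v := by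
  funext l; simp [tilde]

theorem tilde_add {A : Type*} [Add A] (v w : Index r ρ → A) : tilde (v + w) = tilde v + tilde w :=
  rfl

theorem tilde_sub {A : Type*} [Sub A] (v w : Index r ρ → A) : tilde (v - w) = tilde v - tilde w :=
  rfl

theorem tilde_single (l : Index r ρ) : tilde (Pi.single l (1 : ℤ)) = Pi.single l.swap 1 := by
  funext l'
  rcases l with l | l <;> rcases l' with l' | l' <;> simp [tilde, Pi.single_apply]

theorem fstAt_add (v w : Index r ρ → ℤ) : fstAt (v + w) = fstAt v + fstAt w := by
  funext j; simp only [fstAt, Pi.add_apply]; split <;> simp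

theorem sndAt_add (v w : Index r ρ → ℤ) : sndAt (v + w) = sndAt v + sndAt w := by
  funext j; simp only [sndAt, Pi.add_apply]; split <;> simp

theorem trdAt_add (v w : Index r ρ → ℤ) : trdAt (v + w) = trdAt v + trdAt w := by
  funext j; simp only [trdAt, Pi.add_apply]; split <;> simp

theorem fstAt_sub (v w : Index r ρ → ℤ) : fstAt (v - w) = fstAt v - fstAt w := by
  funext j; simp only [fstAt, Pi.sub_apply]; split <;> simp

theorem sndAt_sub (v w : Index r ρ → ℤ) : sndAt (v - w) = sndAt v - sndAt w := by
  funext j; simp only [sndAt, Pi.sub_apply]; split <;> simp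

theorem trdAt_sub (v w : Index r ρ → ℤ) : trdAt (v - w) = trdAt v - trdAt w := by
  funext j; simp only [trdAt, Pi.sub_apply]; split <;> simp

section Single

theorem fstAt_single_fst (i : Fin r) :
    fstAt (Pi.single (.inl (.inl i)) 1 : Index r ρ → ℤ) = Pi.single (i : ℕ) 1 := by
  funext j; simp only [fstAt, Pi.single_apply]; split <;> simp [Fin.ext_iff] <;> omega

theorem fstAt_single_snd (i : {_i : Fin r // 0 < ρ}) :
    fstAt (Pi.single (.inl (.inr (.inl i))) 1 : Index r ρ → ℤ) = 0 := by
  funext j; simp [fstAt]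

theorem fstAt_single_trd (i : Fin (r - 1)) :
    fstAt (Pi.single (.inl (.inr (.inr i))) 1 : Index r ρ → ℤ) = 0 := by
  funext j; simp [fstAt]

theorem fstAt_single_inr (i : HalfIndex ρ r) :
    fstAt (Pi.single (.inr i) 1 : Index r ρ → ℤ) = 0 := by
  funext j; simp [fstAt]

theorem sndAt_single_fst (i : Fin r) :
    sndAt (Pi.single (.inl (.inl i)) 1 : Index r ρ → ℤ) = 0 := by
  funext j; simp [sndAt]

theorem sndAt_single_snd (i : {_i : Fin r // 0 < ρ}) :
    sndAt (Pi.single (.inl (.inr (.inl i))) 1 : Index r ρ → ℤ) = Pi.single (i.1 : ℕ) 1 := by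
  have := i.2
  funext j; simp only [sndAt, Pi.single_apply]; split <;> simp [Subtype.ext_iff, Fin.ext_iff] <;>
    omega

theorem sndAt_single_trd (i : Fin (r - 1)) :
    sndAt (Pi.single (.inl (.inr (.inr i))) 1 : Index r ρ → ℤ) = 0 := by
  funext j; simp [sndAt]

theorem sndAt_single_inr (i : HalfIndex ρ r) :
    sndAt (Pi.single (.inr i) 1 : Index r ρ → ℤ) = 0 := by
  funext j; simp [sndAt]

theorem trdAt_single_fst (i : Fin r) :
    trdAt (Pi.single (.inl (.inl i)) 1 : Index r ρ → ℤ) = 0 := by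
  funext j; simp [trdAt]

theorem trdAt_single_snd (i : {_i : Fin r // 0 < ρ}) :
    trdAt (Pi.single (.inl (.inr (.inl i))) 1 : Index r ρ → ℤ) = 0 := by
  funext j; simp [trdAt]

theorem trdAt_single_trd (i : Fin (r - 1)) :
    trdAt (Pi.single (.inl (.inr (.inr i))) 1 : Index r ρ → ℤ) = Pi.single (i : ℕ) 1 := by
  funext j; simp only [trdAt, Pi.single_apply]; split <;> simp [Fin.ext_iff] <;> omega

theorem trdAt_single_inr (i : HalfIndex ρ r) :
    trdAt (Pi.single (.inr i) 1 : Index r ρ → ℤ) = 0 := by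
  funext j; simp [trdAt]

end Single

/-- The sequence `p_{j-1} + p_j`. -/
def pairSum (q : Index r ρ → ℤ) (j : ℕ) : ℤ := pPrev q j + trdAt q j

theorem pairSum_eq (q : Index r ρ → ℤ) :
    pairSum q = fun j => prevSeq (pPrev q 0) (trdAt q) j + trdAt q j := by
  funext j; rcases j with _ | j <;> rfl

theorem pairSum_add (q q' : Index r ρ → ℤ) : pairSum (q + q') = pairSum q + pairSum q' := by
  funext j
  rcases j with _ | j
  · simp only [pairSum, pPrev, Pi.add_apply, tilde_add, fstAt_add, sndAt_add, trdAt_add,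
      Finset.sum_add_distrib]
    ring
  · simp only [pairSum, pPrev, Pi.add_apply, trdAt_add]
    ring

/-! ### The coefficients with free parameters -/

/-- The expression for `H` at the exponent differences `k`, with `α_j`, `β_j` in place of
`p_{j-1} + p_j` and its tilded version. -/
def fullCoeff (α β : ℕ → ℤ) (k : Index r ρ → ℤ) : ℚ :=
  sumF r α (fstAt k) (sndAt k) (trdAt k) *
      sumF ρ β (fstAt (tilde k)) (sndAt (tilde k)) (trdAt (tilde k)) -
    sumG r α (fstAt k) (sndAt k) (trdAt k) *
      sumG ρ β (fstAt (tilde k)) (sndAt (tilde k)) (trdAt (tilde k))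

theorem fullCoeff_tilde (α β : ℕ → ℤ) (k : Index r ρ → ℤ) :
    fullCoeff β α (tilde k) = fullCoeff α β k := by
  simp only [fullCoeff, tilde_tilde, mul_comm]

theorem fullCoeff_congr {α α' β β' : ℕ → ℤ} (k : Index r ρ → ℤ) (hα : ∀ j < r, α j = α' j)
    (hβ : ∀ j < ρ, β j = β' j) : fullCoeff α β k = fullCoeff α' β' k := by
  simp only [fullCoeff, sumF_congr _ _ _ hα, sumF_congr _ _ _ hβ, sumG_congr _ _ _ hα,
    sumG_congr _ _ _ hβ]

/-- The upper entries depend on q alone and the lower ones on q - q' alone. Decoupling the two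
allows α and β to be shifted independently of the exponents. -/
theorem coeffH_eq_fullCoeff (qp q : Index r ρ → ℤ) :
    coeffH qp q = fullCoeff (pairSum q) (pairSum (tilde q)) (q - qp) := by
  have key : ∀ {r ρ : ℕ} (qp q : Index r ρ → ℤ) (i : ℤ), coeffF qp q i =
      halfProd r (pairSum q) (fun j => fstAt (q - qp) j - kron i j) (sndAt (q - qp))
        (trdAt (q - qp)) i ∧ coeffG qp q i =
      halfProd r (pairSum q) (fstAt (q - qp)) (fun j => sndAt (q - qp) j - kron i j)
        (trdAt (q - qp)) i := by
    intro r ρ qp q i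
    simp only [coeffF, coeffG, halfProd, fstAt_sub, sndAt_sub, trdAt_sub, Pi.sub_apply, pairSum,
      neg_add', and_self]
  simp only [coeffH, fullCoeff, sumF, sumG, Finset.sum_mul_sum, (key _ _ _).1, (key _ _ _).2,
    tilde_sub]

theorem fullCoeff_eq_zero_of_half (α β : ℕ → ℤ) (k : Index r ρ → ℤ) {j : ℕ} (hj : j < r)
    (h : fstAt k j < 0 ∨ sndAt k j < 0 ∨ trdAt k j < 0) : fullCoeff α β k = 0 := by
  rw [fullCoeff, sumF_eq_zero hj h, sumG_eq_zero hj h]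
  simp

theorem exists_half_neg (k : Index r ρ → ℤ) {i : HalfIndex r ρ} (h : k (.inl i) < 0) :
    ∃ j < r, fstAt k j < 0 ∨ sndAt k j < 0 ∨ trdAt k j < 0 := by
  rcases i with i | i | i
  · exact ⟨i, i.2, Or.inl (by simpa [fstAt] using h)⟩
  · exact ⟨i.1, i.1.2, Or.inr (Or.inl (by simpa [sndAt, i.2] using h))⟩
  · exact ⟨i, by omega, Or.inr (Or.inr (by simpa [trdAt] using h))⟩

theorem fullCoeff_eq_zero (α β : ℕ → ℤ) (k : Index r ρ → ℤ) (h : ¬ 0 ≤ k) :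
    fullCoeff α β k = 0 := by
  obtain ⟨l, hl⟩ : ∃ l, k l < 0 := by
    by_contra! hc
    exact h hc
  rcases l with l | l
  · obtain ⟨j, hj, h⟩ := exists_half_neg k hl
    exact fullCoeff_eq_zero_of_half α β k hj h
  · rw [← fullCoeff_tilde]
    obtain ⟨j, hj, h⟩ := exists_half_neg (tilde k) (i := l) hl
    exact fullCoeff_eq_zero_of_half β α _ hj h

/-- Both sums of the untilded half obey the same recursion, and a shift in an untilded variable
leaves the tilded factors unchanged. -/
theorem fullCoeff_pascal (α β : ℕ → ℤ) (k : Index r ρ → ℤ) {j : ℕ} (hj : j < r) :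
    fullCoeff α β k + (if h : j < r - 1 then
        fullCoeff α β (k - Pi.single (.inl (.inr (.inr ⟨j, h⟩))) 1) else 0) =
      fullCoeff (α + Pi.single j 1) β k +
        fullCoeff (α + Pi.single j 1) β (k - Pi.single (.inl (.inl ⟨j, hj⟩)) 1) +
        (if h : 0 < ρ then fullCoeff (α + Pi.single j 1) β
          (k - Pi.single (.inl (.inr (.inl ⟨⟨j, hj⟩, h⟩))) 1) else 0) := by
  have e1 := sumF_pascal α (fstAt k) (sndAt k) (trdAt k) hj
  have e2 := sumG_pascal α (fstAt k) (sndAt k) (trdAt k) hj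
  -- The recursion for the half sums also has terms for the absent variables z_{r-1} and, if ρ = 0,
  -- y_j. There the exponent is read as 0, so its shift is -1 and the term vanishes.
  have ht : ∀ α, ¬ j < r - 1 →
      sumF r α (fstAt k) (sndAt k) (trdAt k - Pi.single j 1) = 0 ∧
      sumG r α (fstAt k) (sndAt k) (trdAt k - Pi.single j 1) = 0 := fun α h => by
    have : (trdAt k - Pi.single j 1 : ℕ → ℤ) j < 0 := by simp [trdAt, h]
    exact ⟨sumF_eq_zero hj (Or.inr (Or.inr this)), sumG_eq_zero hj (Or.inr (Or.inr this))⟩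
  have hs : ∀ α, ¬ 0 < ρ →
      sumF r α (fstAt k) (sndAt k - Pi.single j 1) (trdAt k) = 0 ∧
      sumG r α (fstAt k) (sndAt k - Pi.single j 1) (trdAt k) = 0 := fun α h => by
    have : (sndAt k - Pi.single j 1 : ℕ → ℤ) j < 0 := by simp [sndAt, h]
    exact ⟨sumF_eq_zero hj (Or.inr (Or.inl this)), sumG_eq_zero hj (Or.inr (Or.inl this))⟩
  simp only [fullCoeff, tilde_sub, tilde_single, Sum.swap_inl, fstAt_sub, sndAt_sub, trdAt_sub,
    fstAt_single_fst, fstAt_single_snd, fstAt_single_trd, fstAt_single_inr, sndAt_single_fst,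
    sndAt_single_snd, sndAt_single_trd, sndAt_single_inr, trdAt_single_fst, trdAt_single_snd,
    trdAt_single_trd, trdAt_single_inr, sub_zero]
  split_ifs with h1 h2 h2
  · linear_combination sumF ρ β (fstAt (tilde k)) (sndAt (tilde k)) (trdAt (tilde k)) * e1 -
      sumG ρ β (fstAt (tilde k)) (sndAt (tilde k)) (trdAt (tilde k)) * e2
  · rw [(hs _ h2).1] at e1
    rw [(hs _ h2).2] at e2
    linear_combination sumF ρ β (fstAt (tilde k)) (sndAt (tilde k)) (trdAt (tilde k)) * e1 -
      sumG ρ β (fstAt (tilde k)) (sndAt (tilde k)) (trdAt (tilde k)) * e2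
  · rw [(ht _ h1).1] at e1
    rw [(ht _ h1).2] at e2
    linear_combination sumF ρ β (fstAt (tilde k)) (sndAt (tilde k)) (trdAt (tilde k)) * e1 -
      sumG ρ β (fstAt (tilde k)) (sndAt (tilde k)) (trdAt (tilde k)) * e2
  · rw [(ht _ h1).1, (hs _ h2).1] at e1
    rw [(ht _ h1).2, (hs _ h2).2] at e2
    linear_combination sumF ρ β (fstAt (tilde k)) (sndAt (tilde k)) (trdAt (tilde k)) * e1 -
      sumG ρ β (fstAt (tilde k)) (sndAt (tilde k)) (trdAt (tilde k)) * e2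

theorem fullCoeff_zero (α β : ℕ → ℤ) : fullCoeff α β (0 : Index r ρ → ℤ) = 1 := by
  have hf : ∀ {r ρ : ℕ}, fstAt (0 : Index r ρ → ℤ) = 0 := by intros; funext j; simp [fstAt]
  have hs : ∀ {r ρ : ℕ}, sndAt (0 : Index r ρ → ℤ) = 0 := by intros; funext j; simp [sndAt]
  have ht : ∀ {r ρ : ℕ}, trdAt (0 : Index r ρ → ℤ) = 0 := by intros; funext j; simp [trdAt]
  have h0 : tilde (0 : Index r ρ → ℤ) = 0 := rfl
  rw [fullCoeff, h0, hf, hs, ht, hf, hs, ht, sumG_of_snd_zero r _ 0 0 0 fun _ _ => rfl,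
    sumF_of_fst_zero r _ 0 0 0 fun _ _ => rfl, sumF_of_fst_zero ρ _ 0 0 0 fun _ _ => rfl,
    halfProd_of_zero r _ 0 0 0 fun _ _ => ⟨rfl, rfl, rfl⟩,
    halfProd_of_zero ρ _ 0 0 0 fun _ _ => ⟨rfl, rfl, rfl⟩]
  simp

theorem half_eq_zero (k : Index r ρ → ℤ)
    (h : ∀ j < r, fstAt k j = 0 ∧ sndAt k j = 0 ∧ trdAt k j = 0) (i : HalfIndex r ρ) :
    k (.inl i) = 0 := by
  rcases i with i | i | i
  · simpa [fstAt] using (h i i.2).1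
  · simpa [sndAt, i.2] using (h i.1 i.1.2).2.1
  · simpa [trdAt] using (h i (by omega)).2.2

theorem fstAt_nonneg {k : Index r ρ → ℤ} (hk : 0 ≤ k) (j : ℕ) : 0 ≤ fstAt k j := by
  unfold fstAt; split
  · exact hk _
  · rfl

theorem sndAt_nonneg {k : Index r ρ → ℤ} (hk : 0 ≤ k) (j : ℕ) : 0 ≤ sndAt k j := by
  unfold sndAt; split
  · exact hk _
  · rfl

theorem tilde_nonneg {k : Index r ρ → ℤ} (hk : 0 ≤ k) : 0 ≤ tilde k := fun _ => hk _

theorem fst_snd_zero_of_pPrev_zero {k : Index r ρ → ℤ} (hk : 0 ≤ k) (h : pPrev k 0 = 0) :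
    (∀ j < r, fstAt k j = 0) ∧ ∀ j < ρ, sndAt (tilde k) j = 0 := by
  have h1 : ∀ j ∈ Finset.range r, 0 ≤ fstAt k j := fun j _ => fstAt_nonneg hk j
  have h2 : ∀ j ∈ Finset.range ρ, 0 ≤ sndAt (tilde k) j :=
    fun j _ => sndAt_nonneg (tilde_nonneg hk) j
  obtain ⟨h3, h4⟩ := (add_eq_zero_iff_of_nonneg (Finset.sum_nonneg h1) (Finset.sum_nonneg h2)).1 h
  exact ⟨fun j hj => (Finset.sum_eq_zero_iff_of_nonneg h1).1 h3 j (Finset.mem_range.2 hj),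
    fun j hj => (Finset.sum_eq_zero_iff_of_nonneg h2).1 h4 j (Finset.mem_range.2 hj)⟩

/-- P = 0 kills m and ñ, hence the G-part, and leaves A·ΣF̃. If A ≠ 0 the whole untilded half is
zero, so P̃ = |m̃| and `mul_sumF` gives P̃·ΣF̃ = 0. If also ΣF̃ ≠ 0, then P̃ = 0 and the tilded half
is zero too, contradicting k ≠ 0. -/
theorem fullCoeff_pairSum_of_pPrev_zero {k : Index r ρ → ℤ} (hk : 0 ≤ k) (hk0 : k ≠ 0)
    (h : pPrev k 0 = 0) : fullCoeff (pairSum k) (pairSum (tilde k)) k = 0 := by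
  obtain ⟨h1, h2⟩ := fst_snd_zero_of_pPrev_zero hk h
  rw [fullCoeff, sumG_of_snd_zero ρ _ _ _ _ h2, mul_zero, sub_zero, sumF_of_fst_zero r _ _ _ _ h1]
  by_contra hne
  obtain ⟨hF, hS⟩ := mul_ne_zero_iff.1 hne
  rw [pairSum_eq, h] at hF
  have hz := halfProd_zero_ne_zero _ _ _ _ hF
  have hm := mul_sumF ρ (pPrev (tilde k) 0) (fstAt (tilde k)) (sndAt (tilde k)) (trdAt (tilde k))
  have hP : pPrev (tilde k) 0 = ∑ j ∈ Finset.range ρ, fstAt (tilde k) j := by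
    simp only [pPrev, tilde_tilde, add_eq_left]
    exact Finset.sum_eq_zero fun j hj => (hz j (Finset.mem_range.1 hj)).2.1
  rw [← pairSum_eq, hP] at hm
  push_cast at hm
  rw [sub_self, mul_zero] at hm
  have hP0 : pPrev (tilde k) 0 = 0 := by
    rw [hP]
    exact_mod_cast (mul_eq_zero.1 hm).resolve_right hS
  obtain ⟨h3, -⟩ := fst_snd_zero_of_pPrev_zero (tilde_nonneg hk) hP0
  rw [sumF_of_fst_zero _ _ _ _ _ h3, pairSum_eq, hP0] at hS
  have hz' := halfProd_zero_ne_zero _ _ _ _ hS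
  refine hk0 (funext fun l => ?_)
  rcases l with l | l
  · exact half_eq_zero k hz l
  · exact half_eq_zero (tilde k) hz' l

theorem fullCoeff_pairSum {k : Index r ρ → ℤ} (hk0 : k ≠ 0) :
    fullCoeff (pairSum k) (pairSum (tilde k)) k = 0 := by
  by_cases hk : 0 ≤ k
  swap
  · exact fullCoeff_eq_zero _ _ _ hk
  by_cases h : pPrev k 0 = 0
  · exact fullCoeff_pairSum_of_pPrev_zero hk hk0 h
  by_cases h' : pPrev (tilde k) 0 = 0
  · rw [← fullCoeff_tilde]
    have := fullCoeff_pairSum_of_pPrev_zero (tilde_nonneg hk)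
      (fun h0 => hk0 (by rw [← tilde_tilde k, h0]; rfl)) h'
    rwa [tilde_tilde] at this
  have e1 := mul_sumF r (pPrev k 0) (fstAt k) (sndAt k) (trdAt k)
  have e2 := mul_sumG r (pPrev k 0) (fstAt k) (sndAt k) (trdAt k)
  have e3 := mul_sumF ρ (pPrev (tilde k) 0) (fstAt (tilde k)) (sndAt (tilde k)) (trdAt (tilde k))
  have e4 := mul_sumG ρ (pPrev (tilde k) 0) (fstAt (tilde k)) (sndAt (tilde k)) (trdAt (tilde k))
  rw [← pairSum_eq] at e1 e2 e3 e4
  have hP : (pPrev k 0 : ℚ) = ∑ j ∈ Finset.range r, ((fstAt k j : ℤ) : ℚ) +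
      ∑ j ∈ Finset.range ρ, ((sndAt (tilde k) j : ℤ) : ℚ) := by
    simp only [pPrev]; push_cast; rfl
  have hP' : (pPrev (tilde k) 0 : ℚ) = ∑ j ∈ Finset.range ρ, ((fstAt (tilde k) j : ℤ) : ℚ) +
      ∑ j ∈ Finset.range r, ((sndAt k j : ℤ) : ℚ) := by
    simp only [pPrev, tilde_tilde]; push_cast; rfl
  have hne : (pPrev k 0 : ℚ) * pPrev (tilde k) 0 ≠ 0 := by exact_mod_cast mul_ne_zero h h'
  refine (mul_eq_zero.1 (?_ : ((pPrev k 0 : ℚ) * pPrev (tilde k) 0) * _ = 0)).resolve_left hne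
  have e5 := congrArg₂ (· * ·) e1 e3
  have e6 := congrArg₂ (· * ·) e2 e4
  -- Since P - |m| = |ñ| and P̃ - |m̃| = |n|, the F-part and the G-part both become A·Ã·|n|·|ñ|.
  rw [show (pPrev k 0 : ℚ) - ∑ j ∈ Finset.range r, ((fstAt k j : ℤ) : ℚ) =
    ∑ j ∈ Finset.range ρ, ((sndAt (tilde k) j : ℤ) : ℚ) by rw [hP]; ring,
    show (pPrev (tilde k) 0 : ℚ) - ∑ j ∈ Finset.range ρ, ((fstAt (tilde k) j : ℤ) : ℚ) =
    ∑ j ∈ Finset.range r, ((sndAt k j : ℤ) : ℚ) by rw [hP']; ring] at e5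
  rw [fullCoeff]
  linear_combination e5 - e6

/-! ### Power series -/

theorem MvPowerSeries.isUnit_of_constantCoeff_eq_one {σ K : Type*} [CommRing K]
    {f : MvPowerSeries σ K} (h : MvPowerSeries.constantCoeff f = 1) : IsUnit f :=
  MvPowerSeries.isUnit_iff_constantCoeff.2 (by rw [h]; exact isUnit_one)

/-- A linear form that depends only on the coefficients of bounded degree and vanishes at the
series `X^b φ_b`, where `φ_b` has constant coefficient `1`, is zero. -/
theorem MvPowerSeries.linearMap_eq_zero {σ K : Type*} [Finite σ] [Field K]
    (L : MvPowerSeries σ K →ₗ[K] K) (N : ℕ)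
    (hL : ∀ g, (∀ d : σ →₀ ℕ, d.degree < N → MvPowerSeries.coeff d g = 0) → L g = 0)
    (f : (σ →₀ ℕ) → MvPowerSeries σ K) (hf : ∀ b, MvPowerSeries.constantCoeff (f b) = 1)
    (hLf : ∀ b, L (MvPowerSeries.monomial b 1 * f b) = 0) (g : MvPowerSeries σ K) : L g = 0 := by
  -- Descending induction on the order of g: subtracting the combination of the X^b φ_b with |b| = n
  -- that matches the degree-n part of g raises the order without changing `L g`.
  have key : ∀ n ≤ N, ∀ g : MvPowerSeries σ K,
      (∀ d : σ →₀ ℕ, d.degree < n → MvPowerSeries.coeff d g = 0) → L g = 0 := by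
    intro n hn
    induction hn using Nat.decreasingInduction with
    | self => exact hL
    | of_succ n hn ih =>
      intro g hg
      classical
      have hfin : {b : σ →₀ ℕ | b.degree = n}.Finite :=
        (Finsupp.finite_of_degree_le n).subset fun b hb => le_of_eq hb
      set T := hfin.toFinset
      have hsum : L (∑ b ∈ T, MvPowerSeries.coeff b g • (MvPowerSeries.monomial b 1 * f b)) = 0 := by
        simp [map_sum, hLf]
      have := ih (g - ∑ b ∈ T, MvPowerSeries.coeff b g • (MvPowerSeries.monomial b 1 * f b)) ?_
      · rwa [map_sub, hsum, sub_zero] at this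
      intro d hd
      rw [map_sub, map_sum, sub_eq_zero]
      have hterm : ∀ b ∈ T, MvPowerSeries.coeff d
          (MvPowerSeries.coeff b g • (MvPowerSeries.monomial b 1 * f b)) =
          if b = d then MvPowerSeries.coeff d g else 0 := by
        intro b hb
        have hb : b.degree = n := by simpa [T] using hb
        rw [map_smul, MvPowerSeries.coeff_monomial_mul, one_mul]
        split_ifs with h1 h2 h2
        · subst h2
          simp [hf]
        -- Here b ≤ d while |d| ≤ n = |b|, which forces d = b.
        · have h3 : d = b + (d - b) := (add_tsub_cancel_of_le h1).symm
          have h4 : d.degree = b.degree + (d - b).degree := by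
            conv_lhs => rw [h3]
            exact map_add _ _ _
          have h5 : d - b = 0 := (Finsupp.degree_eq_zero_iff _).1 (by omega)
          rw [h5, add_zero] at h3
          exact absurd h3.symm h2
        · exact absurd h2.le h1
        · simp
      rw [Finset.sum_congr rfl hterm, Finset.sum_ite_eq']
      split_ifs with h
      · rfl
      · refine hg d (lt_of_le_of_ne (by omega) fun h' => h (by simpa [T] using h'))
  exact key 0 (Nat.zero_le _) g (by simp)

theorem MvPowerSeries.coeff_subst_eq_zero {σ K : Type*} [Finite σ] [Field K]
    {η : σ → MvPowerSeries σ K} (hη : ∀ l, MvPowerSeries.constantCoeff (η l) = 0) (n : ℕ)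
    (g : MvPowerSeries σ K) (hg : ∀ d : σ →₀ ℕ, d.degree < n → MvPowerSeries.coeff d g = 0)
    (d : σ →₀ ℕ) (hd : d.degree < n) : MvPowerSeries.coeff d (g.subst η) = 0 := by
  have hs := MvPowerSeries.hasSubst_of_constantCoeff_zero hη
  apply MvPowerSeries.coeff_of_lt_order
  refine lt_of_lt_of_le ?_ (MvPowerSeries.le_order_subst hs g)
  have h1 : (1 : ℕ∞) ≤ ⨅ i, (η i).order :=
    le_iInf fun i => MvPowerSeries.one_le_order_iff_constCoeff_eq_zero.2 (hη i)
  calc (d.degree : ℕ∞) < n := by exact_mod_cast hd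
    _ ≤ g.order := MvPowerSeries.nat_le_order hg
    _ = 1 * g.order := (one_mul _).symm
    _ ≤ _ := by gcongr

theorem MvPowerSeries.coeff_mul_eq_zero {σ K : Type*} [CommRing K] {n : ℕ}
    {g : MvPowerSeries σ K} (hg : ∀ d : σ →₀ ℕ, d.degree < n → MvPowerSeries.coeff d g = 0)
    (c : MvPowerSeries σ K) (d : σ →₀ ℕ) (hd : d.degree < n) :
    MvPowerSeries.coeff d (g * c) = 0 := by
  classical
  rw [MvPowerSeries.coeff_mul]
  refine Finset.sum_eq_zero fun x hx => ?_
  have h := congrArg Finsupp.degree (Finset.HasAntidiagonal.mem_antidiagonal.1 hx)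
  rw [map_add] at h
  rw [hg x.1 (by omega), zero_mul]

/-! ### Powers of a unit acting on a family by translations -/

theorem Units.zpow_mul_translate {A M : Type*} [CommRing A] [AddCommGroup M] (u : Aˣ) (s : M → A)
    (v : M) (h : ∀ a, u * s a = s (a + v)) (z : ℤ) (a : M) :
    ((u ^ z : Aˣ) : A) * s a = s (a + z • v) := by
  have h' : ∀ a, ((u⁻¹ : Aˣ) : A) * s a = s (a - v) := fun a => by
    rw [Units.inv_mul_eq_iff_eq_mul, h, sub_add_cancel]
  induction z using Int.induction_on generalizing a with
  | zero => simp
  | succ i ih =>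
    rw [zpow_add_one, mul_comm (u ^ _) u, Units.val_mul, mul_assoc, ih, h, add_smul, one_smul,
      add_assoc]
  | pred i ih =>
    rw [zpow_sub_one, mul_comm (u ^ _) u⁻¹, Units.val_mul, mul_assoc, ih, h', sub_smul, one_smul,
      add_sub_assoc]

theorem Units.prod_zpow_mul_translate {A M ι : Type*} [CommRing A] [AddCommGroup M] (t : Finset ι)
    (u : ι → Aˣ) (s : M → A) (v : ι → M) (h : ∀ j ∈ t, ∀ a, u j * s a = s (a + v j)) (z : ι → ℤ)
    (a : M) : ((∏ j ∈ t, u j ^ z j : Aˣ) : A) * s a = s (a + ∑ j ∈ t, z j • v j) := by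
  classical
  induction t using Finset.induction_on generalizing a with
  | empty => simp
  | insert j t hj ih =>
    rw [Finset.prod_insert hj, Units.val_mul, mul_assoc,
      ih (fun i hi => h i (Finset.mem_insert_of_mem hi)),
      Units.zpow_mul_translate _ s _ (h j (Finset.mem_insert_self _ _)), Finset.sum_insert hj,
      add_assoc, add_comm (∑ j ∈ t, _)]

/-! ### The generating series of the coefficients -/

section CoeffSeries

variable {K : Type*} [Field K]

/-- The exponent vector `e` as an integer vector. -/
def intExp {σ : Type*} (e : σ →₀ ℕ) : σ → ℤ := fun l => e l

/-- The series with the coefficients `fullCoeff α β`. -/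
def coeffSeries (K : Type*) [Field K] (α β : ℕ → ℤ) : MvPowerSeries (Index r ρ) K :=
  fun e => ((fullCoeff α β (intExp e) : ℚ) : K)

theorem coeff_coeffSeries (α β : ℕ → ℤ) (e : Index r ρ →₀ ℕ) :
    MvPowerSeries.coeff e (coeffSeries K α β) = ((fullCoeff α β (intExp e) : ℚ) : K) := rfl

theorem coeff_monomial_mul_coeffSeries (α β : ℕ → ℤ) (b e : Index r ρ →₀ ℕ) :
    MvPowerSeries.coeff e (MvPowerSeries.monomial b 1 * coeffSeries K α β) =
      ((fullCoeff α β (intExp e - intExp b) : ℚ) : K) := by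
  rw [MvPowerSeries.coeff_monomial_mul]
  split_ifs with h
  · rw [one_mul, coeff_coeffSeries]
    congr 2
    funext l
    have := h l
    simp [intExp]
    omega
  · rw [fullCoeff_eq_zero, Rat.cast_zero]
    refine fun h' => h fun l => ?_
    have := h' l
    simp [intExp] at this
    omega

theorem intExp_single {σ : Type*} (l : σ) [DecidableEq σ] :
    intExp (Finsupp.single l 1) = Pi.single l 1 := by
  funext l'
  rw [intExp, Finsupp.single_apply, Pi.single_apply]
  split_ifs with h1 h2 h2
  · simp
  · exact absurd h1.symm h2
  · exact absurd h2.symm h1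
  · simp

theorem coeff_X_mul_coeffSeries (α β : ℕ → ℤ) (l : Index r ρ) (e : Index r ρ →₀ ℕ) :
    MvPowerSeries.coeff e (MvPowerSeries.X l * coeffSeries K α β) =
      ((fullCoeff α β (intExp e - Pi.single l 1) : ℚ) : K) := by
  rw [← intExp_single, ← coeff_monomial_mul_coeffSeries]
  rfl

/-- The family of the variables. -/
noncomputable def varFamily (r ρ : ℕ) (K : Type*) [Field K] : Index r ρ → MvPowerSeries (Index r ρ) K :=
  fun l => MvPowerSeries.X l

/-- The series form of `fullCoeff_pascal`: multiplication by φ_j raises α_j by 1. -/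
theorem translate_coeffSeries [CharZero K] (α β : ℕ → ℤ) {j : ℕ} (hj : j < r) :
    (1 + trdAt (varFamily r ρ K) j) * coeffSeries K α β =
      (1 + fstAt (varFamily r ρ K) j + sndAt (varFamily r ρ K) j) *
        coeffSeries K (α + Pi.single j 1) β := by
  ext e
  have h := congrArg (Rat.cast : ℚ → K) (fullCoeff_pascal α β (intExp e) hj)
  simp only [add_mul, one_mul, map_add, coeff_coeffSeries, fstAt, sndAt, trdAt, varFamily, hj,
    dite_true, coeff_X_mul_coeffSeries, true_and]
  push_cast at h
  convert h using 2
  · split_ifs with h1 <;> simp [coeff_X_mul_coeffSeries]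
  · split_ifs with h1 <;> simp [coeff_X_mul_coeffSeries]

theorem translate_coeffSeries_tilde [CharZero K] (α β : ℕ → ℤ) {j : ℕ} (hj : j < ρ) :
    (1 + trdAt (tilde (varFamily r ρ K)) j) * coeffSeries K α β =
      (1 + fstAt (tilde (varFamily r ρ K)) j + sndAt (tilde (varFamily r ρ K)) j) *
        coeffSeries K α (β + Pi.single j 1) := by
  ext e
  have h := congrArg (Rat.cast : ℚ → K) (fullCoeff_pascal β α (tilde (intExp e)) hj)
  have hs : ∀ (α β : ℕ → ℤ) (l : Index ρ r), fullCoeff α β (intExp e - Pi.single l.swap 1) =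
      fullCoeff β α (tilde (intExp e) - Pi.single l 1) := fun α β l => by
    rw [← fullCoeff_tilde, tilde_sub, tilde_single, Sum.swap_swap]
  simp only [add_mul, one_mul, map_add, coeff_coeffSeries, fstAt, sndAt, trdAt, varFamily, hj,
    dite_true, coeff_X_mul_coeffSeries, true_and, tilde, hs, ← fullCoeff_tilde α]
  push_cast at h
  convert h using 2
  · split_ifs with h1 <;> simp [coeff_X_mul_coeffSeries, ← hs]
  · split_ifs with h1 <;> simp [coeff_X_mul_coeffSeries, ← hs]

/-! ### The units `(1 + w_j) / (1 + s_j + t_j)` -/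

section Step

variable {σ : Type*} (ζ : Index r ρ → MvPowerSeries σ K)

theorem constantCoeff_fstAt {ζ : Index r ρ → MvPowerSeries σ K}
    (hζ : ∀ l, MvPowerSeries.constantCoeff (ζ l) = 0) (j : ℕ) :
    MvPowerSeries.constantCoeff (fstAt ζ j) = 0 := by
  unfold fstAt; split <;> simp [hζ]

theorem constantCoeff_sndAt {ζ : Index r ρ → MvPowerSeries σ K}
    (hζ : ∀ l, MvPowerSeries.constantCoeff (ζ l) = 0) (j : ℕ) :
    MvPowerSeries.constantCoeff (sndAt ζ j) = 0 := by
  unfold sndAt; split <;> simp [hζ]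

theorem constantCoeff_trdAt {ζ : Index r ρ → MvPowerSeries σ K}
    (hζ : ∀ l, MvPowerSeries.constantCoeff (ζ l) = 0) (j : ℕ) :
    MvPowerSeries.constantCoeff (trdAt ζ j) = 0 := by
  unfold trdAt; split <;> simp [hζ]

/-- The unit `(1 + w_j) / (1 + s_j + t_j)`, with the entries of `ζ` for the variables. -/
noncomputable def stepUnit (hζ : ∀ l, MvPowerSeries.constantCoeff (ζ l) = 0) (j : ℕ) :
    (MvPowerSeries σ K)ˣ :=
  (MvPowerSeries.isUnit_of_constantCoeff_eq_one (f := 1 + trdAt ζ j)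
      (by simp [constantCoeff_trdAt hζ])).unit *
    (MvPowerSeries.isUnit_of_constantCoeff_eq_one (f := 1 + fstAt ζ j + sndAt ζ j)
      (by simp [constantCoeff_fstAt hζ, constantCoeff_sndAt hζ])).unit⁻¹

variable {ζ}

theorem stepUnit_mul (hζ : ∀ l, MvPowerSeries.constantCoeff (ζ l) = 0) (j : ℕ) :
    (stepUnit ζ hζ j : MvPowerSeries σ K) * (1 + fstAt ζ j + sndAt ζ j) = 1 + trdAt ζ j := by
  rw [stepUnit, Units.val_mul, mul_assoc, IsUnit.val_inv_mul, mul_one, IsUnit.unit_spec]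

theorem constantCoeff_stepUnit (hζ : ∀ l, MvPowerSeries.constantCoeff (ζ l) = 0) (j : ℕ) :
    MvPowerSeries.constantCoeff (stepUnit ζ hζ j : MvPowerSeries σ K) = 1 := by
  have := congrArg MvPowerSeries.constantCoeff (stepUnit_mul hζ j)
  simpa [constantCoeff_fstAt hζ, constantCoeff_sndAt hζ, constantCoeff_trdAt hζ] using this

end Step

theorem constantCoeff_varFamily (l : Index r ρ) :
    MvPowerSeries.constantCoeff (varFamily r ρ K l) = 0 := by
  simp [varFamily]

theorem constantCoeff_tilde_varFamily (l : Index ρ r) :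
    MvPowerSeries.constantCoeff (tilde (varFamily r ρ K) l) = 0 :=
  constantCoeff_varFamily _

/-- The unit `φ^q` for which `ξ^q = η^q / φ^q`, as a series in the Lagrange variables. -/
noncomputable def phi (K : Type*) [Field K] (q : Index r ρ → ℤ) : (MvPowerSeries (Index r ρ) K)ˣ :=
  (∏ j ∈ Finset.range r, stepUnit (varFamily r ρ K) constantCoeff_varFamily j ^ pairSum q j) *
    ∏ j ∈ Finset.range ρ,
      stepUnit (tilde (varFamily r ρ K)) constantCoeff_tilde_varFamily j ^ pairSum (tilde q) j

theorem constantCoeff_phi (q : Index r ρ → ℤ) :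
    MvPowerSeries.constantCoeff (phi K q : MvPowerSeries (Index r ρ) K) = 1 := by
  have h : Units.map ((MvPowerSeries.constantCoeff : MvPowerSeries (Index r ρ) K →+* K) :
      MvPowerSeries (Index r ρ) K →* K) (phi K q) = 1 := by
    have key : ∀ u : (MvPowerSeries (Index r ρ) K)ˣ,
        MvPowerSeries.constantCoeff (u : MvPowerSeries (Index r ρ) K) = 1 → Units.map
          ((MvPowerSeries.constantCoeff : MvPowerSeries (Index r ρ) K →+* K) :
            MvPowerSeries (Index r ρ) K →* K) u = 1 := fun u hu => Units.ext hu
    simp only [phi, map_mul, map_prod, map_zpow, key _ (constantCoeff_stepUnit _ _), one_zpow,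
      Finset.prod_const_one, mul_one]
  exact congrArg Units.val h

theorem sum_smul_single (n : ℕ) (z : ℕ → ℤ) {j : ℕ} (hj : j < n) :
    (∑ i ∈ Finset.range n, z i • (Pi.single i 1 : ℕ → ℤ)) j = z j := by
  rw [Finset.sum_apply, Finset.sum_eq_single j]
  · simp
  · intro i _ hi
    simp [hi.symm]
  · intro h
    exact absurd (Finset.mem_range.2 hj) h

theorem coeffSeries_congr {α α' β β' : ℕ → ℤ} (hα : ∀ j < r, α j = α' j)
    (hβ : ∀ j < ρ, β j = β' j) :
    (coeffSeries K α β : MvPowerSeries (Index r ρ) K) = coeffSeries K α' β' := by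
  ext e
  rw [coeff_coeffSeries, coeff_coeffSeries, fullCoeff_congr _ hα hβ]

theorem phi_mul_coeffSeries [CharZero K] (q : Index r ρ → ℤ) (α β : ℕ → ℤ) :
    (phi K q : MvPowerSeries (Index r ρ) K) * coeffSeries K α β =
      coeffSeries K (α + pairSum q) (β + pairSum (tilde q)) := by
  rw [phi, Units.val_mul, mul_assoc,
    Units.prod_zpow_mul_translate _ _ (fun β => coeffSeries K α β) (fun j => Pi.single j 1),
    Units.prod_zpow_mul_translate _ _ (fun α => coeffSeries K α _) (fun j => Pi.single j 1)]
  · refine coeffSeries_congr (fun j hj => ?_) (fun j hj => ?_)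
    · rw [Pi.add_apply, sum_smul_single _ _ hj, Pi.add_apply]
    · rw [Pi.add_apply, sum_smul_single _ _ hj, Pi.add_apply]
  · intro j hj α
    refine (MvPowerSeries.isUnit_of_constantCoeff_eq_one (f := 1 + fstAt (varFamily r ρ K) j +
      sndAt (varFamily r ρ K) j) ?_).mul_left_cancel ?_
    · simp [constantCoeff_fstAt constantCoeff_varFamily, constantCoeff_sndAt constantCoeff_varFamily]
    · rw [← translate_coeffSeries α _ (Finset.mem_range.1 hj), ← stepUnit_mul constantCoeff_varFamily j]
      ring
  · intro j hj β
    refine (MvPowerSeries.isUnit_of_constantCoeff_eq_one (f := 1 +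
      fstAt (tilde (varFamily r ρ K)) j + sndAt (tilde (varFamily r ρ K)) j) ?_).mul_left_cancel ?_
    · simp [constantCoeff_fstAt constantCoeff_tilde_varFamily,
        constantCoeff_sndAt constantCoeff_tilde_varFamily]
    · rw [← translate_coeffSeries_tilde _ β (Finset.mem_range.1 hj),
        ← stepUnit_mul constantCoeff_tilde_varFamily j]
      ring

end CoeffSeries

/-! ### Existence and uniqueness of the solution -/

section Agree

variable {σ K : Type*} [CommRing K]

/-- The series `f` and `g` have the same coefficients in degrees below `n`. -/
def Agree (n : ℕ) (f g : MvPowerSeries σ K) : Prop :=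
  ∀ d : σ →₀ ℕ, d.degree < n → MvPowerSeries.coeff d f = MvPowerSeries.coeff d g

variable {n : ℕ} {f f' g g' : MvPowerSeries σ K}

theorem Agree.refl (n : ℕ) (f : MvPowerSeries σ K) : Agree n f f := fun _ _ => rfl

theorem Agree.symm (h : Agree n f g) : Agree n g f := fun d hd => (h d hd).symm

theorem Agree.trans {k : MvPowerSeries σ K} (h : Agree n f g) (h' : Agree n g k) : Agree n f k :=
  fun d hd => (h d hd).trans (h' d hd)

theorem Agree.add (h : Agree n f g) (h' : Agree n f' g') : Agree n (f + f') (g + g') :=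
  fun d hd => by rw [map_add, map_add, h d hd, h' d hd]

theorem Agree.sub (h : Agree n f g) (h' : Agree n f' g') : Agree n (f - f') (g - g') :=
  fun d hd => by rw [map_sub, map_sub, h d hd, h' d hd]

theorem Agree.sum {ι : Type*} {t : Finset ι} {F G : ι → MvPowerSeries σ K}
    (h : ∀ j ∈ t, Agree n (F j) (G j)) : Agree n (∑ j ∈ t, F j) (∑ j ∈ t, G j) :=
  fun d hd => by
    rw [map_sum, map_sum]
    exact Finset.sum_congr rfl fun j hj => h j hj d hd

theorem Agree.mul (h : Agree n f g) (h' : Agree n f' g') : Agree n (f * f') (g * g') := by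
  classical
  intro d hd
  rw [MvPowerSeries.coeff_mul, MvPowerSeries.coeff_mul]
  refine Finset.sum_congr rfl fun x hx => ?_
  have hx := congrArg Finsupp.degree (Finset.HasAntidiagonal.mem_antidiagonal.1 hx)
  rw [map_add] at hx
  rw [h x.1 (by omega), h' x.2 (by omega)]

/-- The source of the contraction: a factor without constant term gains one degree of agreement. -/
theorem Agree.mul_left_succ {x : MvPowerSeries σ K} (hx : MvPowerSeries.constantCoeff x = 0)
    (h : Agree n f g) : Agree (n + 1) (x * f) (x * g) := by
  classical
  intro d hd
  rw [MvPowerSeries.coeff_mul, MvPowerSeries.coeff_mul]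
  refine Finset.sum_congr rfl fun y hy => ?_
  have hy := congrArg Finsupp.degree (Finset.HasAntidiagonal.mem_antidiagonal.1 hy)
  rw [map_add] at hy
  by_cases h0 : y.1 = 0
  · rw [h0, MvPowerSeries.coeff_zero_eq_constantCoeff_apply, hx, zero_mul, zero_mul]
  · have := (Finsupp.degree_eq_zero_iff y.1).not.2 h0
    rw [h y.2 (by omega)]

/-- A contraction with respect to the degree filtration has exactly one fixed point. -/
theorem existsUnique_fixedPoint {J : Type*}
    (Φ : (J → MvPowerSeries σ K) → J → MvPowerSeries σ K)
    (hΦ : ∀ n v w, (∀ j, Agree n (v j) (w j)) → ∀ j, Agree (n + 1) (Φ v j) (Φ w j)) :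
    ∃! v, Φ v = v := by
  have hstep : ∀ n m j, n ≤ m → Agree n (Φ^[n] 0 j) (Φ^[m] 0 j) := by
    intro n
    induction n with
    | zero => intro m j _ d hd; omega
    | succ n ih =>
      intro m j hm
      obtain ⟨m, rfl⟩ : ∃ m', m = m' + 1 := ⟨m - 1, by omega⟩
      rw [Function.iterate_succ_apply', Function.iterate_succ_apply']
      exact hΦ n _ _ (fun j => ih m j (by omega)) j
  -- The coefficient at d is constant along the iterates from number |d| + 1 on, so it can be read
  -- off there.
  let v : J → MvPowerSeries σ K :=
    fun j d => MvPowerSeries.coeff d (Φ^[d.degree + 1] 0 j)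
  have hv : ∀ n j, Agree n (v j) (Φ^[n] 0 j) := fun n j d hd => hstep _ _ j hd d (Nat.lt_succ_self _)
  refine ⟨v, ?_, ?_⟩
  · funext j
    ext d
    have h1 := hΦ d.degree v (Φ^[d.degree] 0) (hv _) j d (Nat.lt_succ_self _)
    rw [h1, ← Function.iterate_succ_apply' Φ]
    rfl
  · intro w hw
    have : ∀ n j, Agree n (w j) (v j) := by
      intro n
      induction n with
      | zero => intro j d hd; omega
      | succ n ih =>
        intro j
        rw [← hw]
        refine (hΦ n w (Φ^[n] 0) (fun j => (ih j).trans (hv n j)) j).trans ?_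
        rw [← Function.iterate_succ_apply' Φ]
        exact (hv (n + 1) j).symm
    funext j
    ext d
    exact this _ j d (Nat.lt_succ_self _)

theorem Agree.extU {u u' : Fin r → MvPowerSeries σ K} (h : ∀ i, Agree n (u i) (u' i)) (j : ℕ) :
    Agree n (extU u j) (extU u' j) := by
  rcases j with _ | j
  · exact Agree.refl _ _
  · simp only [_root_.extU]
    split
    · exact h _
    · exact Agree.refl _ _

/-- The increment `u_{i+1} - u_i` prescribed by the quadratic system. -/
def increment {A : Type*} [CommRing A] (ξ : Index r ρ → A) (u : Fin r → A) (ut : Fin ρ → A)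
    (i : ℕ) : A :=
  trdAt ξ i * extU u (i + 2) - fstAt ξ i * (extU u 1 * extU u (i + 1)) -
    sndAt ξ i * (extU ut 1 * extU u (i + 1))

/-- As written, the system has the bare term u_{i-1} on the right and is not visibly a contraction.
After telescoping down to u_0 = 1, every unknown on the right is multiplied by one of the variables.
-/
theorem halfSystem_iff {A : Type*} [CommRing A] (ξ : Index r ρ → A) (u : Fin r → A)
    (ut : Fin ρ → A) : HalfSystem ξ u ut ↔
      ∀ i : Fin r, 1 + ∑ j ∈ Finset.range (i + 1), increment ξ u ut j = u i := by
  have hE : ∀ i : Fin r, extU u (i + 1) = u i := fun i => by simp [extU]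
  have hsys : HalfSystem ξ u ut ↔ ∀ i < r, extU u (i + 1) = extU u i + increment ξ u ut i := by
    refine forall₂_congr fun i _ => ?_
    rw [increment]
    constructor <;> intro h <;> linear_combination h
  rw [hsys]
  constructor
  · intro h
    have : ∀ i ≤ r, 1 + ∑ j ∈ Finset.range i, increment ξ u ut j = extU u i := by
      intro i
      induction i with
      | zero => intro _; simp [extU]
      | succ i ih =>
        intro hi
        rw [Finset.sum_range_succ, ← add_assoc, ih (by omega), h i (by omega)]
    intro i
    rw [this _ i.2, hE]
  · intro h i hi
    have h1 := h ⟨i, hi⟩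
    rw [← hE, Finset.sum_range_succ] at h1
    simp only at h1
    rw [← h1, ← add_assoc, add_left_inj]
    rcases i with _ | i
    · simp [extU]
    · have h2 := h ⟨i, by omega⟩
      rw [← hE] at h2
      exact h2

theorem agree_increment {ξ : Index r ρ → MvPowerSeries σ K}
    (hx : ∀ j, MvPowerSeries.constantCoeff (fstAt ξ j) = 0)
    (hy : ∀ j, MvPowerSeries.constantCoeff (sndAt ξ j) = 0)
    (hz : ∀ j, MvPowerSeries.constantCoeff (trdAt ξ j) = 0)
    {u u' : Fin r → MvPowerSeries σ K} {ut ut' : Fin ρ → MvPowerSeries σ K}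
    (h : ∀ i, Agree n (u i) (u' i)) (ht : ∀ i, Agree n (ut i) (ut' i)) (j : ℕ) :
    Agree (n + 1) (increment ξ u ut j) (increment ξ u' ut' j) :=
  ((Agree.mul_left_succ (hz j) (Agree.extU h _)).sub
    (Agree.mul_left_succ (hx j) ((Agree.extU h _).mul (Agree.extU h _)))).sub
    (Agree.mul_left_succ (hy j) ((Agree.extU ht _).mul (Agree.extU h _)))

end Agree

theorem existsUnique_isSolution (K : Type*) [Field K] (r ρ : ℕ) :
    ∃! v : (Fin r → MvPowerSeries (Index r ρ) K) × (Fin ρ → MvPowerSeries (Index r ρ) K),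
      IsSolution v.1 v.2 := by
  let ξ := varFamily r ρ K
  let Φ : (Fin r ⊕ Fin ρ → MvPowerSeries (Index r ρ) K) →
      Fin r ⊕ Fin ρ → MvPowerSeries (Index r ρ) K := fun v =>
    Sum.elim
      (fun i => 1 + ∑ j ∈ Finset.range (i + 1), increment ξ (v ∘ Sum.inl) (v ∘ Sum.inr) j)
      (fun i => 1 + ∑ j ∈ Finset.range (i + 1), increment (tilde ξ) (v ∘ Sum.inr) (v ∘ Sum.inl) j)
  have hsol : ∀ v : Fin r ⊕ Fin ρ → MvPowerSeries (Index r ρ) K,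
      IsSolution (v ∘ Sum.inl) (v ∘ Sum.inr) ↔ Φ v = v := fun v => by
    have h1 := halfSystem_iff ξ (v ∘ Sum.inl) (v ∘ Sum.inr)
    have h2 := halfSystem_iff (tilde ξ) (v ∘ Sum.inr) (v ∘ Sum.inl)
    rw [funext_iff, Sum.forall]
    exact and_congr h1 h2
  have hζ := constantCoeff_varFamily (r := r) (ρ := ρ) (K := K)
  have hζ' := constantCoeff_tilde_varFamily (r := r) (ρ := ρ) (K := K)
  obtain ⟨v, hv, huniq⟩ := existsUnique_fixedPoint Φ (by
    intro n v w h j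
    rcases j with j | j
    · exact (Agree.refl _ _).add (Agree.sum fun i _ =>
        agree_increment (constantCoeff_fstAt hζ) (constantCoeff_sndAt hζ) (constantCoeff_trdAt hζ)
          (fun i => h (.inl i)) (fun i => h (.inr i)) i)
    · exact (Agree.refl _ _).add (Agree.sum fun i _ =>
        agree_increment (constantCoeff_fstAt hζ') (constantCoeff_sndAt hζ')
          (constantCoeff_trdAt hζ') (fun i => h (.inr i)) (fun i => h (.inl i)) i))
  refine ⟨(v ∘ Sum.inl, v ∘ Sum.inr), (hsol v).2 hv, ?_⟩
  rintro ⟨u, ut⟩ hu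
  have := huniq (Sum.elim u ut) ((hsol _).1 (by simpa using hu))
  rw [← this]
  simp

/-! ### Powers of units indexed by exponent vectors -/

section UnitPow

variable {G : Type*} [CommGroup G]

/-- The product of the powers `u_j^{p_{j-1} + p_j}` and their tilded versions. -/
def unitPow (u v : ℕ → G) (q : Index r ρ → ℤ) : G :=
  (∏ j ∈ Finset.range r, u j ^ pairSum q j) * ∏ j ∈ Finset.range ρ, v j ^ pairSum (tilde q) j

theorem unitPow_add (u v : ℕ → G) (q q' : Index r ρ → ℤ) :
    unitPow u v (q + q') = unitPow u v q * unitPow u v q' := by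
  simp only [unitPow, tilde_add, pairSum_add, Pi.add_apply, zpow_add, Finset.prod_mul_distrib]
  exact mul_mul_mul_comm _ _ _ _

theorem unitPow_tilde (u v : ℕ → G) (q : Index r ρ → ℤ) :
    unitPow v u (tilde q) = unitPow u v q := by
  rw [unitPow, unitPow, tilde_tilde, mul_comm]

theorem unitPow_eq_prod (u v : ℕ → G) (q : Index r ρ → ℤ) :
    unitPow u v q = ∏ l, unitPow u v (Pi.single l 1 : Index r ρ → ℤ) ^ q l := by
  let F : (Index r ρ → ℤ) →+ Additive G :=
    AddMonoidHom.mk' (fun q => Additive.ofMul (unitPow u v q)) fun q q' => unitPow_add u v q q'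
  have hq : q = ∑ l, q l • (Pi.single l 1 : Index r ρ → ℤ) := by
    conv_lhs => rw [← Finset.univ_sum_single q]
    refine Finset.sum_congr rfl fun l _ => ?_
    rw [← Pi.single_smul, smul_eq_mul, mul_one]
  have h := congrArg F hq
  rw [map_sum] at h
  simp only [map_zsmul] at h
  exact h

theorem prod_zpow_single {n j : ℕ} (hj : j < n) (u : ℕ → G) :
    ∏ i ∈ Finset.range n, u i ^ (Pi.single j 1 : ℕ → ℤ) i = u j := by
  rw [Finset.prod_eq_single j]
  · simp
  · intro i _ hi
    simp [hi]
  · intro h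
    exact absurd (Finset.mem_range.2 hj) h

theorem sum_range_single {n j : ℕ} (hj : j < n) :
    ∑ i ∈ Finset.range n, (Pi.single j 1 : ℕ → ℤ) i = 1 := by
  rw [Finset.sum_eq_single j]
  · simp
  · intro i _ hi
    simp [hi]
  · intro h
    exact absurd (Finset.mem_range.2 hj) h

theorem pairSum_single_fst (i : Fin r) :
    pairSum (Pi.single (.inl (.inl i)) 1 : Index r ρ → ℤ) = Pi.single 0 1 := by
  funext j
  rcases j with _ | j
  · simp [pairSum, pPrev, tilde_single, fstAt_single_fst, sndAt_single_inr, trdAt_single_fst,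
      sum_range_single i.2]
  · simp [pairSum, pPrev, trdAt_single_fst]

theorem pairSum_single_snd (i : {_i : Fin r // 0 < ρ}) :
    pairSum (Pi.single (.inl (.inr (.inl i))) 1 : Index r ρ → ℤ) = 0 := by
  funext j
  rcases j with _ | j
  · simp [pairSum, pPrev, tilde_single, fstAt_single_snd, sndAt_single_inr, trdAt_single_snd]
  · simp [pairSum, pPrev, trdAt_single_snd]

theorem pairSum_single_trd (i : Fin (r - 1)) :
    pairSum (Pi.single (.inl (.inr (.inr i))) 1 : Index r ρ → ℤ) =
      Pi.single (i : ℕ) 1 + Pi.single ((i : ℕ) + 1) 1 := by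
  funext j
  rcases j with _ | j
  · simp [pairSum, pPrev, tilde_single, fstAt_single_trd, sndAt_single_inr, trdAt_single_trd]
  · simp [pairSum, pPrev, trdAt_single_trd, Pi.single_apply, add_comm]

theorem pairSum_single_inr_fst (i : Fin ρ) :
    pairSum (Pi.single (.inr (.inl i)) 1 : Index r ρ → ℤ) = 0 := by
  funext j
  rcases j with _ | j
  · simp [pairSum, pPrev, tilde_single, fstAt_single_inr, sndAt_single_fst, trdAt_single_inr]
  · simp [pairSum, pPrev, trdAt_single_inr]

theorem pairSum_single_inr_snd (i : {_i : Fin ρ // 0 < r}) :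
    pairSum (Pi.single (.inr (.inr (.inl i))) 1 : Index r ρ → ℤ) = Pi.single 0 1 := by
  funext j
  rcases j with _ | j
  · simp [pairSum, pPrev, tilde_single, fstAt_single_inr, sndAt_single_snd, trdAt_single_inr,
      sum_range_single i.1.2]
  · simp [pairSum, pPrev, trdAt_single_inr]

theorem pairSum_single_inr_trd (i : Fin (ρ - 1)) :
    pairSum (Pi.single (.inr (.inr (.inr i))) 1 : Index r ρ → ℤ) = 0 := by
  funext j
  rcases j with _ | j
  · simp [pairSum, pPrev, tilde_single, fstAt_single_inr, sndAt_single_trd, trdAt_single_inr]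
  · simp [pairSum, pPrev, trdAt_single_inr]

theorem unitPow_single_fst (u v : ℕ → G) (i : Fin r) :
    unitPow u v (Pi.single (.inl (.inl i)) 1 : Index r ρ → ℤ) = u 0 := by
  rw [unitPow, tilde_single, Sum.swap_inl, pairSum_single_fst, pairSum_single_inr_fst,
    prod_zpow_single i.pos]
  simp

theorem unitPow_single_snd (u v : ℕ → G) (i : {_i : Fin r // 0 < ρ}) :
    unitPow u v (Pi.single (.inl (.inr (.inl i))) 1 : Index r ρ → ℤ) = v 0 := by
  rw [unitPow, tilde_single, Sum.swap_inl, pairSum_single_snd, pairSum_single_inr_snd,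
    prod_zpow_single i.2]
  simp

theorem unitPow_single_trd (u v : ℕ → G) (i : Fin (r - 1)) :
    unitPow u v (Pi.single (.inl (.inr (.inr i))) 1 : Index r ρ → ℤ) = u i * u (i + 1) := by
  rw [unitPow, tilde_single, Sum.swap_inl, pairSum_single_trd, pairSum_single_inr_trd]
  simp only [Pi.add_apply, zpow_add, Finset.prod_mul_distrib]
  rw [prod_zpow_single (by omega), prod_zpow_single (by omega)]
  simp

theorem map_unitPow {H : Type*} [CommGroup H] (f : G →* H) (u v : ℕ → G) (q : Index r ρ → ℤ) :
    f (unitPow u v q) = unitPow (fun j => f (u j)) (fun j => f (v j)) q := by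
  simp only [unitPow, map_mul, map_prod, map_zpow]

end UnitPow

/-! ### The Lagrange variables as power series -/

section Lagrange

variable {σ K : Type*} [Field K]

/-- The untilded half of the Lagrange variables, as power series. -/
noncomputable def halfLagrangeSeries (ξ : Index r ρ → MvPowerSeries σ K)
    (u : Fin r → MvPowerSeries σ K) (ut : Fin ρ → MvPowerSeries σ K) :
    HalfIndex r ρ → MvPowerSeries σ K
  | .inl i => ξ (.inl (.inl i)) * extU u 1
  | .inr (.inl i) => ξ (.inl (.inr (.inl i))) * extU ut 1
  | .inr (.inr i) => ξ (.inl (.inr (.inr i))) * (extU u ((i : ℕ) + 2) * (extU u (i : ℕ))⁻¹)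

/-- The Lagrange variables, as power series. -/
noncomputable def lagrangeSeries (ξ : Index r ρ → MvPowerSeries σ K)
    (u : Fin r → MvPowerSeries σ K) (ut : Fin ρ → MvPowerSeries σ K) :
    Index r ρ → MvPowerSeries σ K :=
  Sum.elim (halfLagrangeSeries ξ u ut) (halfLagrangeSeries (tilde ξ) ut u)

variable {ξ : Index r ρ → MvPowerSeries σ K} {u : Fin r → MvPowerSeries σ K}
  {ut : Fin ρ → MvPowerSeries σ K}

theorem tilde_lagrangeSeries :
    tilde (lagrangeSeries ξ u ut) = lagrangeSeries (tilde ξ) ut u := by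
  funext l
  rcases l with l | l <;> simp [lagrangeSeries, tilde]

theorem constantCoeff_lagrangeSeries (hξ : ∀ l, MvPowerSeries.constantCoeff (ξ l) = 0)
    (l : Index r ρ) : MvPowerSeries.constantCoeff (lagrangeSeries ξ u ut l) = 0 := by
  rcases l with (l | l | l) | (l | l | l) <;>
    simp [lagrangeSeries, halfLagrangeSeries, hξ, tilde]

theorem constantCoeff_extU (hξ : ∀ l, MvPowerSeries.constantCoeff (ξ l) = 0)
    (h : HalfSystem ξ u ut) {i : ℕ} (hi : i ≤ r) :
    MvPowerSeries.constantCoeff (extU u i) = 1 := by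
  induction i with
  | zero => simp [extU]
  | succ i ih =>
    have := congrArg MvPowerSeries.constantCoeff (h i (by omega))
    simpa [constantCoeff_fstAt hξ, constantCoeff_sndAt hξ, constantCoeff_trdAt hξ,
      ih (by omega)] using this

/-- The quadratic terms are absorbed by x_j u_1 = s_j, y_j ũ_1 = t_j and z_j u_{j+2} = w_j u_j,
leaving a two-term recursion. -/
theorem extU_succ_mul (hξ : ∀ l, MvPowerSeries.constantCoeff (ξ l) = 0)
    (h : HalfSystem ξ u ut) {j : ℕ} (hj : j < r) :
    extU u (j + 1) * (1 + fstAt (lagrangeSeries ξ u ut) j + sndAt (lagrangeSeries ξ u ut) j) =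
      extU u j * (1 + trdAt (lagrangeSeries ξ u ut) j) := by
  have h1 : fstAt (lagrangeSeries ξ u ut) j = fstAt ξ j * extU u 1 := by
    simp [fstAt, hj, lagrangeSeries, halfLagrangeSeries]
  have h2 : sndAt (lagrangeSeries ξ u ut) j = sndAt ξ j * extU ut 1 := by
    simp only [sndAt, hj, lagrangeSeries, true_and]
    split <;> simp [halfLagrangeSeries]
  have hu : extU u j * (extU u j)⁻¹ = 1 :=
    MvPowerSeries.mul_inv_cancel _ (by rw [constantCoeff_extU hξ h hj.le]; exact one_ne_zero)
  have h3 : extU u j * trdAt (lagrangeSeries ξ u ut) j = trdAt ξ j * extU u (j + 2) := by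
    simp only [trdAt]
    split
    · simp only [lagrangeSeries, halfLagrangeSeries, Sum.elim_inl]
      linear_combination ξ (.inl (.inr (.inr ⟨j, ‹_›⟩))) * extU u (j + 2) * hu
    · simp
  rw [h1, h2]
  linear_combination h j hj - h3

theorem map_fstAt {A B : Type*} [CommRing A] [CommRing B] (S : A →+* B) (v : Index r ρ → A)
    (j : ℕ) : S (fstAt v j) = fstAt (fun l => S (v l)) j := by
  unfold fstAt; split <;> simp

theorem map_sndAt {A B : Type*} [CommRing A] [CommRing B] (S : A →+* B) (v : Index r ρ → A)
    (j : ℕ) : S (sndAt v j) = sndAt (fun l => S (v l)) j := by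
  unfold sndAt; split <;> simp

theorem map_trdAt {A B : Type*} [CommRing A] [CommRing B] (S : A →+* B) (v : Index r ρ → A)
    (j : ℕ) : S (trdAt v j) = trdAt (fun l => S (v l)) j := by
  unfold trdAt; split <;> simp

theorem map_stepUnit_mul {τ : Type*} (S : MvPowerSeries τ K →+* MvPowerSeries σ K)
    {ζ : Index r ρ → MvPowerSeries τ K} (hζ : ∀ l, MvPowerSeries.constantCoeff (ζ l) = 0)
    (hS : ∀ l, S (ζ l) = lagrangeSeries ξ u ut l)
    (hξ : ∀ l, MvPowerSeries.constantCoeff (ξ l) = 0)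
    (h : HalfSystem ξ u ut) {j : ℕ} (hj : j < r) :
    S (stepUnit ζ hζ j) * extU u j = extU u (j + 1) := by
  have h1 := congrArg S (stepUnit_mul hζ j)
  simp only [map_mul, map_add, map_one, map_fstAt, map_sndAt, map_trdAt, hS] at h1
  have hc := constantCoeff_lagrangeSeries (u := u) (ut := ut) hξ
  refine (MvPowerSeries.isUnit_of_constantCoeff_eq_one (f := 1 +
    fstAt (lagrangeSeries ξ u ut) j + sndAt (lagrangeSeries ξ u ut) j) ?_).mul_right_cancel ?_
  · simp [constantCoeff_fstAt hc, constantCoeff_sndAt hc]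
  · have h2 := extU_succ_mul hξ h hj
    linear_combination extU u j * h1 - h2

/-- With U_j = u_{j+1}/u_j one has u_1 = U_0 and u_{i+2}/u_i = U_i U_{i+1}. So z_i enters the
exponents of U_i and U_{i+1}, and the variables multiplied by u_1 enter that of U_0: these are the
exponents p_{j-1} + p_j. -/
theorem halfLagrangeSeries_eq (hξ : ∀ l, MvPowerSeries.constantCoeff (ξ l) = 0)
    (h : HalfSystem ξ u ut) {U V : ℕ → (MvPowerSeries σ K)ˣ}
    (hU : ∀ j < r, (U j : MvPowerSeries σ K) * extU u j = extU u (j + 1))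
    (hV : ∀ j < ρ, (V j : MvPowerSeries σ K) * extU ut j = extU ut (j + 1)) (i : HalfIndex r ρ) :
    halfLagrangeSeries ξ u ut i = ξ (.inl i) *
      (unitPow U V (Pi.single (.inl i) 1 : Index r ρ → ℤ) : (MvPowerSeries σ K)ˣ) := by
  rcases i with i | i | i
  · have := hU 0 i.pos
    rw [unitPow_single_fst, halfLagrangeSeries, ← this]
    simp [extU]
  · have := hV 0 i.2
    rw [unitPow_single_snd, halfLagrangeSeries, ← this]
    simp [extU]
  · have h1 := hU i (by omega)
    have h2 := hU (i + 1) (by omega)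
    have hu : extU u i * (extU u i)⁻¹ = 1 :=
      MvPowerSeries.mul_inv_cancel _
        (by rw [constantCoeff_extU hξ h (by omega)]; exact one_ne_zero)
    rw [unitPow_single_trd, halfLagrangeSeries, Units.val_mul, show (i : ℕ) + 2 = i + 1 + 1 from rfl,
      ← h2, ← h1]
    linear_combination ξ (.inl (.inr (.inr i))) * U i * U (i + 1) * hu

theorem lagrangeSeries_eq (hξ : ∀ l, MvPowerSeries.constantCoeff (ξ l) = 0)
    (h : HalfSystem ξ u ut) (h' : HalfSystem (tilde ξ) ut u) {U V : ℕ → (MvPowerSeries σ K)ˣ}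
    (hU : ∀ j < r, (U j : MvPowerSeries σ K) * extU u j = extU u (j + 1))
    (hV : ∀ j < ρ, (V j : MvPowerSeries σ K) * extU ut j = extU ut (j + 1)) (l : Index r ρ) :
    lagrangeSeries ξ u ut l = ξ l *
      (unitPow U V (Pi.single l 1 : Index r ρ → ℤ) : (MvPowerSeries σ K)ˣ) := by
  rcases l with l | l
  · exact halfLagrangeSeries_eq hξ h hU hV l
  · rw [← unitPow_tilde, tilde_single]
    exact halfLagrangeSeries_eq (ξ := tilde ξ) (fun _ => hξ _) h' hV hU l

theorem halfLagrangeVar_algebraMap {L : Type*} [Field L] (f : MvPowerSeries σ K →+* L)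
    (hξ : ∀ l, MvPowerSeries.constantCoeff (ξ l) = 0)
    (h : HalfSystem ξ u ut) (i : HalfIndex r ρ) :
    halfLagrangeVar (fun l => f (ξ l)) (fun j => f (u j)) (fun j => f (ut j)) i =
      f (halfLagrangeSeries ξ u ut i) := by
  have hE : ∀ {r : ℕ} (u : Fin r → MvPowerSeries σ K) (j : ℕ),
      extU (fun i => f (u i)) j = f (extU u j) := by
    intro r u j
    rcases j with _ | j
    · simp [extU]
    · simp only [extU]; split <;> simp
  rcases i with i | i | i
  · simp [halfLagrangeVar, halfLagrangeSeries, hE]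
  · simp [halfLagrangeVar, halfLagrangeSeries, hE]
  · simp only [halfLagrangeVar, halfLagrangeSeries, hE, map_mul]
    congr 1
    have hu : extU u i * (extU u i)⁻¹ = 1 :=
      MvPowerSeries.mul_inv_cancel _
        (by rw [constantCoeff_extU hξ h (by omega)]; exact one_ne_zero)
    have hf := congrArg f hu
    rw [map_mul, map_one] at hf
    have h0 : f (extU u i) ≠ 0 := left_ne_zero_of_mul_eq_one hf
    rw [div_eq_iff h0, mul_assoc, mul_comm (f (extU u i)⁻¹), hf, mul_one]

end Lagrange

theorem lagrangeVar_eq {K : Type*} [Field K] {u : Fin r → MvPowerSeries (Index r ρ) K}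
    {ut : Fin ρ → MvPowerSeries (Index r ρ) K} (h : IsSolution u ut) (l : Index r ρ) :
    lagrangeVar u ut l = algebraMap _ (FractionRing (MvPowerSeries (Index r ρ) K))
      (lagrangeSeries (varFamily r ρ K) u ut l) := by
  rcases l with l | l
  · exact halfLagrangeVar_algebraMap
      (algebraMap _ (FractionRing (MvPowerSeries (Index r ρ) K))) constantCoeff_varFamily h.1 l
  · exact halfLagrangeVar_algebraMap
      (algebraMap _ (FractionRing (MvPowerSeries (Index r ρ) K))) constantCoeff_tilde_varFamily h.2 l

/-! ### The expansion -/

theorem prod_X_pow {σ K : Type*} [Fintype σ] [Field K] (b : σ →₀ ℕ) :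
    ∏ l, (MvPowerSeries.X l : MvPowerSeries σ K) ^ b l = MvPowerSeries.monomial b 1 := by
  rw [MvPowerSeries.monomial_one_eq, Finsupp.prod_fintype _ _ (by simp)]

/-- Substituting the Lagrange variables into `g` amounts to pairing with the coefficient series. -/
theorem coeff_subst_lagrangeSeries {K : Type*} [Field K] [CharZero K]
    {η : Index r ρ → MvPowerSeries (Index r ρ) K}
    (hη : ∀ l, MvPowerSeries.constantCoeff (η l) = 0)
    (hS : ∀ (b : Index r ρ →₀ ℕ), MvPowerSeries.subst η
      (MvPowerSeries.monomial b 1 * (phi K (-intExp b) : MvPowerSeries (Index r ρ) K)) =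
        MvPowerSeries.monomial b (1 : K))
    (e : Index r ρ →₀ ℕ) (g : MvPowerSeries (Index r ρ) K) :
    MvPowerSeries.coeff e (g.subst η) = MvPowerSeries.coeff e
      (g * coeffSeries K (pairSum (intExp e)) (pairSum (tilde (intExp e)))) := by
  classical
  have hs := MvPowerSeries.hasSubst_of_constantCoeff_zero hη
  set c : MvPowerSeries (Index r ρ) K :=
    coeffSeries K (pairSum (intExp e)) (pairSum (tilde (intExp e))) with hc
  -- The difference of the two sides as a linear form in g; it ignores degrees above |e| because η
  -- has no constant terms.
  let L : MvPowerSeries (Index r ρ) K →ₗ[K] K :=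
    (MvPowerSeries.coeff e).comp (MvPowerSeries.substAlgHom (R := K) hs).toLinearMap -
      (MvPowerSeries.coeff e).comp (LinearMap.mulRight K c)
  have hLapp : ∀ g, L g = MvPowerSeries.coeff e (g.subst η) - MvPowerSeries.coeff e (g * c) :=
    fun g => by
      simp only [L, LinearMap.sub_apply, LinearMap.comp_apply, AlgHom.toLinearMap_apply,
        MvPowerSeries.substAlgHom_apply, LinearMap.mulRight_apply]
  have h0 := MvPowerSeries.linearMap_eq_zero L (e.degree + 1) (fun g hg => by
      rw [hLapp, MvPowerSeries.coeff_subst_eq_zero hη _ g hg e (Nat.lt_succ_self _),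
        MvPowerSeries.coeff_mul_eq_zero hg c e (Nat.lt_succ_self _), sub_zero])
    (fun b => (phi K (-intExp b) : MvPowerSeries (Index r ρ) K)) (fun b => constantCoeff_phi _)
    (fun b => by
      -- The factor φ^{-b} moves the parameters of e to those of e - b, and the monomial moves the
      -- coefficient to e - b as well: the diagonal case.
      rw [hLapp, hS, mul_assoc, hc, phi_mul_coeffSeries, ← pairSum_add,
        ← pairSum_add, ← tilde_add, coeff_monomial_mul_coeffSeries, ← sub_eq_add_neg,
        MvPowerSeries.coeff_monomial]
      split_ifs with h
      · rw [h, sub_self, fullCoeff_zero]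
        simp
      · rw [fullCoeff_pairSum]
        · simp
        · intro h'
          refine h (Finsupp.ext fun l => ?_)
          have := congrFun h' l
          simp [intExp] at this
          omega) g
  rwa [hLapp, sub_eq_zero] at h0

theorem coeffH_eq_zero (q' q : Index r ρ → ℤ) (h : ¬ q' ≤ q) : coeffH q' q = 0 := by
  rw [coeffH_eq_fullCoeff]
  exact fullCoeff_eq_zero _ _ _ (by rwa [sub_nonneg])

theorem isLaurentExpansion_lagrangeVar {K : Type*} [Field K] [CharZero K]
    {u : Fin r → MvPowerSeries (Index r ρ) K} {ut : Fin ρ → MvPowerSeries (Index r ρ) K}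
    (h : IsSolution u ut) (q' : Index r ρ → ℤ) :
    IsLaurentExpansion (∏ l, lagrangeVar u ut l ^ q' l) (fun q => (coeffH q' q : K)) := by
  set η := lagrangeSeries (varFamily r ρ K) u ut with hηdef
  have hη : ∀ l, MvPowerSeries.constantCoeff (η l) = 0 :=
    constantCoeff_lagrangeSeries constantCoeff_varFamily
  have hs := MvPowerSeries.hasSubst_of_constantCoeff_zero hη
  let S : MvPowerSeries (Index r ρ) K →+* MvPowerSeries (Index r ρ) K :=
    (MvPowerSeries.substAlgHom (R := K) hs : _ →+* _)
  have hSapp : ∀ g, S g = g.subst η := fun g => MvPowerSeries.substAlgHom_apply hs g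
  let U : ℕ → (MvPowerSeries (Index r ρ) K)ˣ := fun j =>
    Units.map (S : MvPowerSeries (Index r ρ) K →* MvPowerSeries (Index r ρ) K)
      (stepUnit (varFamily r ρ K) constantCoeff_varFamily j)
  let V : ℕ → (MvPowerSeries (Index r ρ) K)ˣ := fun j =>
    Units.map (S : MvPowerSeries (Index r ρ) K →* MvPowerSeries (Index r ρ) K)
      (stepUnit (tilde (varFamily r ρ K)) constantCoeff_tilde_varFamily j)
  have hSX : ∀ l, S (varFamily r ρ K l) = η l := fun l => by
    rw [hSapp]; exact MvPowerSeries.subst_X hs l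
  have hU : ∀ j < r, (U j : MvPowerSeries (Index r ρ) K) * extU u j = extU u (j + 1) :=
    fun j hj => map_stepUnit_mul S constantCoeff_varFamily hSX constantCoeff_varFamily h.1 hj
  have hV : ∀ j < ρ, (V j : MvPowerSeries (Index r ρ) K) * extU ut j = extU ut (j + 1) :=
    fun j hj => map_stepUnit_mul S constantCoeff_tilde_varFamily
      (fun l => (hSX l.swap).trans (congrFun tilde_lagrangeSeries l))
      constantCoeff_tilde_varFamily h.2 hj
  -- W q is φ^q evaluated at η, so that η^q = ξ^q W q.
  let W : (Index r ρ → ℤ) → (MvPowerSeries (Index r ρ) K)ˣ := unitPow U V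
  have hηW : ∀ l, η l = varFamily r ρ K l * (W (Pi.single l 1) : MvPowerSeries (Index r ρ) K) :=
    lagrangeSeries_eq constantCoeff_varFamily h.1 h.2 hU hV
  have hSphi : ∀ q, S (phi K q : MvPowerSeries (Index r ρ) K) = (W q : MvPowerSeries _ K) :=
    fun q => congrArg Units.val (map_unitPow (Units.map
      (S : MvPowerSeries (Index r ρ) K →* MvPowerSeries (Index r ρ) K)) _ _ q)
  have hWprod : ∀ q, W q = ∏ l, W (Pi.single l 1) ^ q l := unitPow_eq_prod U V
  have hWadd : ∀ q q', W (q + q') = W q * W q' := unitPow_add U V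
  have hSmon : ∀ b : Index r ρ →₀ ℕ, S (MvPowerSeries.monomial b 1) =
      MvPowerSeries.monomial b 1 * (W (intExp b) : MvPowerSeries (Index r ρ) K) := fun b => by
    rw [← prod_X_pow, map_prod, hWprod, Units.coe_prod, ← Finset.prod_mul_distrib]
    refine Finset.prod_congr rfl fun l _ => ?_
    rw [map_pow, show S (MvPowerSeries.X l) = η l from hSX l, hηW, mul_pow, intExp, zpow_natCast,
      Units.val_pow_eq_pow_val]
    rfl
  have hSmonphi : ∀ (b : Index r ρ →₀ ℕ) (q : Index r ρ → ℤ), MvPowerSeries.subst η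
      (MvPowerSeries.monomial b 1 * (phi K q : MvPowerSeries (Index r ρ) K)) =
        MvPowerSeries.monomial b 1 * (W (intExp b + q) : MvPowerSeries (Index r ρ) K) :=
    fun b q => by
      rw [← hSapp, map_mul, hSmon, hSphi, hWadd, Units.val_mul, mul_assoc]
  have hW0 : W 0 = 1 := by
    have := hWadd 0 0
    rwa [add_zero, left_eq_mul] at this
  have hcoeff := coeff_subst_lagrangeSeries hη fun b => by
    rw [hSmonphi, add_neg_cancel, hW0, Units.val_one, mul_one]
  -- a and b are the negative and positive parts of q', so η^{q'} ξ^a = ξ^b W(q') is a power series.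
  let a : Index r ρ →₀ ℕ := Finsupp.equivFunOnFinite.symm fun l => (-q' l).toNat
  let b : Index r ρ →₀ ℕ := Finsupp.equivFunOnFinite.symm fun l => (q' l).toNat
  have hab : ∀ l, (b l : ℤ) = a l + q' l := fun l => by
    simp only [a, b, Finsupp.equivFunOnFinite_symm_apply_apply]
    omega
  have hb : intExp b = intExp a + q' := funext hab
  refine ⟨a, MvPowerSeries.monomial b 1 * (W q' : MvPowerSeries (Index r ρ) K), ?_, ?_, ?_⟩
  · set ι := algebraMap (MvPowerSeries (Index r ρ) K) (FractionRing (MvPowerSeries (Index r ρ) K))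
    have hX : ∀ l : Index r ρ, ι (MvPowerSeries.X l) ≠ 0 := fun l => by
      rw [Ne, FaithfulSMul.algebraMap_eq_zero_iff]
      intro h0
      have := congrArg (MvPowerSeries.coeff (Finsupp.single l 1)) h0
      rw [MvPowerSeries.coeff_index_single_self_X, map_zero] at this
      exact one_ne_zero this
    have hιW : ι (W q' : MvPowerSeries (Index r ρ) K) =
        ∏ l, ι (W (Pi.single l 1) : MvPowerSeries (Index r ρ) K) ^ q' l := by
      have := congrArg (fun w => ((Units.map (ι : MvPowerSeries (Index r ρ) K →* _) w :
        (FractionRing (MvPowerSeries (Index r ρ) K))ˣ) :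
          FractionRing (MvPowerSeries (Index r ρ) K))) (hWprod q')
      simpa [map_prod, map_zpow, Units.coe_prod, Units.val_zpow_eq_zpow_val] using this
    rw [map_mul, hιW, ← prod_X_pow, ← prod_X_pow, map_prod, map_prod, ← Finset.prod_mul_distrib,
      ← Finset.prod_mul_distrib]
    refine Finset.prod_congr rfl fun l _ => ?_
    rw [lagrangeVar_eq h, ← hηdef, hηW, map_mul, mul_zpow, map_pow, map_pow, ← zpow_natCast,
      ← zpow_natCast, hab, zpow_add₀ (hX l)]
    simp only [varFamily]
    ring
  · intro e
    have h1 : (fun l => (e l : ℤ) - a l) = intExp e - intExp a := rfl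
    -- This presents ξ^b W(q') as the substitution of η into the monomial of exponent b times
    -- φ^{-a}. Its coefficient at e is the one of C_{e-a} at e - b = (e - a) - q'.
    have h2 : q' = intExp b + -intExp a := by rw [hb]; abel
    beta_reduce
    rw [h1]
    conv_rhs => rw [h2, ← hSmonphi, hcoeff, mul_assoc, phi_mul_coeffSeries, ← pairSum_add,
      ← pairSum_add, ← tilde_add, coeff_monomial_mul_coeffSeries, ← sub_eq_add_neg]
    rw [coeffH_eq_fullCoeff, hb, sub_sub]
  · rintro q ⟨l, hl⟩
    beta_reduce
    rw [coeffH_eq_zero q' q, Rat.cast_zero]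
    intro hq
    have h1 : q' l ≤ q l := hq l
    have h2 := hab l
    omega

theorem theorem4 (K : Type*) [Field K] [CharZero K] (r ρ : ℕ) :
    (∃! v : (Fin r → MvPowerSeries (Index r ρ) K) × (Fin ρ → MvPowerSeries (Index r ρ) K),
      IsSolution v.1 v.2) ∧
    ∀ (u : Fin r → MvPowerSeries (Index r ρ) K) (ut : Fin ρ → MvPowerSeries (Index r ρ) K),
      IsSolution u ut →
      ∀ q' : Index r ρ → ℤ,
        IsLaurentExpansion (∏ l, lagrangeVar u ut l ^ q' l) (fun q => (coeffH q' q : K)) ∧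
        ∀ q : Index r ρ → ℤ, ¬ q' ≤ q → coeffH q' q = 0 :=
  ⟨existsUnique_isSolution K r ρ, fun _ _ h q' =>
    ⟨isLaurentExpansion_lagrangeVar h q', fun q => coeffH_eq_zero q' q⟩⟩
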